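/- A caterpillar is a finite tree in which all vertices of degree at least 3 lie on a single path (its legs may be arbitrarily long). For every caterpillar $T$, the class of finite simple graphs that contain neither $T$ nor the complement of $T$ as an induced subgraph has the strong Erdős–Hajnal property. That is, for every caterpillar $T$ there is a constant $\delta>0$ such that every graph $G$ on $n\neq 1$ vertices that contains neither $T$ nor the complement of $T$ as an induced subgraph has two disjoint sets $A,B\subseteq V(G)$ with $|A|\ge\delta n$ and $|B|\ge\delta n$ such that either all possible edges between $A$ and $B$ are present in $G$, or there are no edges between $A$ and $B$ in $G$. -/

import Mathlib

universe u v

/-- A caterpillar (with legs of arbitrary length): a tree in which all vertices of degree at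
least three lie on a single path. -/
def IsCaterpillar {V : Type u} (T : SimpleGraph V) [T.LocallyFinite] : Prop :=
  T.IsTree ∧ ∃ (a b : V) (p : T.Walk a b), p.IsPath ∧ ∀ x : V, 3 ≤ T.degree x → x ∈ p.support

/-- All possible edges between `A` and `B` are present. -/
def FullyAdjacent {V : Type u} (G : SimpleGraph V) (A B : Finset V) : Prop :=
  ∀ a ∈ A, ∀ b ∈ B, G.Adj a b

/-- There are no edges between `A` and `B`. -/
def AntiAdjacent {V : Type u} (G : SimpleGraph V) (A B : Finset V) : Prop :=
  ∀ a ∈ A, ∀ b ∈ B, ¬ G.Adj a b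

/-- A class `𝒢` of graphs has the strong Erdős–Hajnal property: for some `δ > 0`, every finite
`n`-vertex graph of the class has two disjoint vertex sets of size at least `δ * n` each that are
fully adjacent or anti-adjacent. The one-vertex graph, which has no two disjoint nonempty vertex
sets, is left out. -/
def HasStrongErdosHajnalProperty (𝒢 : ∀ V : Type u, SimpleGraph V → Prop) : Prop :=
  ∃ δ : ℝ, 0 < δ ∧ ∀ (V : Type u) [Fintype V] (G : SimpleGraph V),
    𝒢 V G → Fintype.card V ≠ 1 →
      ∃ A B : Finset V, Disjoint A B ∧
        δ * (Fintype.card V : ℝ) ≤ (A.card : ℝ) ∧ δ * (Fintype.card V : ℝ) ≤ (B.card : ℝ) ∧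
        (FullyAdjacent G A B ∨ AntiAdjacent G A B)

/-- The class of graphs that contain neither `T` nor the complement of `T` as an induced
subgraph. -/
def ExcludesWithComplement {U : Type v} (T : SimpleGraph U) (V : Type u) (G : SimpleGraph V) :
    Prop :=
  ¬ T.IsIndContained G ∧ ¬ Tᶜ.IsIndContained G

/-! ### Rödl's theorem on sparse or co-sparse linear-sized sets. -/

section Rodl

/-! By Rödl's theorem (`exists_sparse_or_cosparse`) a graph without an induced `T` has a
linear-sized vertex set on which it or its complement has small maximum degree. Excluding both `T`
and `Tᶜ` is invariant under complementation, so it is enough to find, in the sparse case, two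
linear-sized sets without edges between them. If there are none, the graph induced on that set is
`Coherent`, and the heart of the proof is that a coherent graph contains every caterpillar
(`IsCaterpillar.exists_forall_coherent_isIndContained`).

In a coherent graph a new vertex hits few vertices, while any set that is not small hits nearly
everything outside it. Hence a set can be grown until it has just hit a quarter of one of several
targets `P i`; most of every other target is then still untouched (`Coherent.exists_first_hit`).
With almost spanning connected pieces and a Gyárfás path argument, this also yields long induced
paths that start at the vertices hit (`Coherent.exists_subset_hit_path`).

The caterpillar arises from a merging game on disjoint candidate sets ("tokens"), each vertex of
which ends the spine of a partial caterpillar. A round spends a token `x` to hit a token `y`. The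
growth process decides which `y` is hit, so `x` has to be chosen such that every outcome is useful
(`exists_next_token`): either `y` gains a leg, or the vertices of `y` extend the spines of `x`. The
rank `t * (d + 1) + h` of the new token exceeds both old ranks, so the sum of `2 ^ rank` never
decreases. Of `2 ^ (m * (d + 1))` bare tokens one is finally left, with rank at least `m * (d + 1)`
and thus at least `m` spine vertices that carry all their legs. -/

open scoped Classical in
/-- The neighbours of `v` in `B`. -/
noncomputable def nbrsIn {V : Type u} (K : SimpleGraph V) (v : V) (B : Finset V) : Finset V :=
  B.filter (K.Adj v)

theorem mem_nbrsIn {V : Type u} {K : SimpleGraph V} {v x : V} {B : Finset V} :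
    x ∈ nbrsIn K v B ↔ x ∈ B ∧ K.Adj v x := by
  classical
  simp [nbrsIn]

theorem nbrsIn_subset {V : Type u} (K : SimpleGraph V) (v : V) (B : Finset V) :
    nbrsIn K v B ⊆ B := fun _ hx => (mem_nbrsIn.1 hx).1

theorem nbrsIn_mono {V : Type u} (K : SimpleGraph V) (v : V) {A B : Finset V} (h : A ⊆ B) :
    nbrsIn K v A ⊆ nbrsIn K v B :=
  fun _ hx => mem_nbrsIn.2 ⟨h (mem_nbrsIn.1 hx).1, (mem_nbrsIn.1 hx).2⟩

theorem sum_card_nbrsIn_comm {V : Type u} (K : SimpleGraph V) (A B : Finset V) :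
    ∑ b ∈ B, ((nbrsIn K b A).card : ℝ) = ∑ a ∈ A, ((nbrsIn K a B).card : ℝ) := by
  classical
  simp only [nbrsIn, Finset.card_filter, Nat.cast_sum]
  rw [Finset.sum_comm]
  simp only [K.adj_comm]

open scoped Classical in
/-- Greedy embedding: a family of disjoint sets contains a transversal induced copy of `H`, or
two linear-sized parts of it have density close to `0` or `1`. -/
theorem exists_transversal_or_sparse_pair (n : ℕ) : ∀ (H : SimpleGraph (Fin n)) (ε : ℝ), 0 < ε →
    ∃ δ : ℝ, 0 < δ ∧ δ ≤ 1 ∧ ∀ (V : Type u) (G : SimpleGraph V) (W : Fin n → Finset V) (N : ℝ),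
      (∀ i j, i ≠ j → Disjoint (W i) (W j)) → 0 < N → (∀ i, N ≤ (W i).card) →
      (∃ f : Fin n → V, (∀ i, f i ∈ W i) ∧ ∀ i j, i < j → (G.Adj (f i) (f j) ↔ H.Adj i j)) ∨
      ∃ i j, i ≠ j ∧ ∃ A ⊆ W i, ∃ B ⊆ W j, δ * N ≤ A.card ∧ δ * N ≤ B.card ∧
        ((∀ a ∈ A, ((nbrsIn G a B).card : ℝ) ≤ ε * B.card) ∨
          ∀ a ∈ A, ((nbrsIn Gᶜ a B).card : ℝ) ≤ ε * B.card) := by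
  induction n with
  | zero =>
    intro H ε hε
    exact ⟨1, one_pos, le_rfl, fun V G W N _ _ _ => Or.inl ⟨Fin.elim0, fun i => i.elim0, fun i => i.elim0⟩⟩
  | succ n ih =>
    intro H ε hε
    obtain ⟨δ, hδ, hδ1, h⟩ := ih (H.comap Fin.succ) ε hε
    -- The term `1 / (n + 1)` is the pigeonhole share of a bad set in `W 0`: `n` sets below this
    -- share cannot cover `W 0`. The term `ε * δ` pays for shrinking the other parts by the factor
    -- `ε` before the induction hypothesis is applied.
    refine ⟨min (1 / (n + 1)) (ε * δ), by positivity, ?_, ?_⟩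
    · refine (min_le_left _ _).trans ?_
      rw [div_le_one (by positivity)]
      linarith [(Nat.cast_nonneg n : (0 : ℝ) ≤ n)]
    intro V G W N hW hN hNW
    set K : Fin n → SimpleGraph V := fun j => if H.Adj 0 j.succ then G else Gᶜ with hK
    set Bad : Fin n → Finset V := fun j => (W 0).filter
      (fun v => ((nbrsIn (K j) v (W j.succ)).card : ℝ) ≤ ε * (W j.succ).card) with hBad
    by_cases hb : ∃ j, ((W 0).card : ℝ) / (n + 1) ≤ (Bad j).card
    · obtain ⟨j, hj⟩ := hb
      right
      refine ⟨0, j.succ, (Fin.succ_ne_zero j).symm, Bad j, Finset.filter_subset _ _, W j.succ, subset_rfl,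
        ?_, ?_, ?_⟩
      · refine le_trans ?_ hj
        calc min (1 / ((n : ℝ) + 1)) (ε * δ) * N ≤ 1 / ((n : ℝ) + 1) * N := by
              gcongr; exact min_le_left _ _
          _ ≤ 1 / ((n : ℝ) + 1) * (W 0).card := by gcongr; exact hNW 0
          _ = _ := by ring
      · refine le_trans ?_ (hNW j.succ)
        calc min (1 / ((n : ℝ) + 1)) (ε * δ) * N ≤ 1 * N := by
              gcongr
              refine (min_le_left _ _).trans ?_
              rw [div_le_one (by positivity)]
              linarith [(Nat.cast_nonneg n : (0 : ℝ) ≤ n)]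
          _ = N := one_mul N
      · by_cases hH : H.Adj 0 j.succ
        · left
          intro a ha
          have := (Finset.mem_filter.1 ha).2
          simpa [hK, hH] using this
        · right
          intro a ha
          have := (Finset.mem_filter.1 ha).2
          simpa only [hK, hH, if_false] using this
    · push Not at hb
      obtain ⟨v, hv, hvb⟩ : ∃ v ∈ W 0, ∀ j, v ∉ Bad j := by
        by_contra! hcon
        have h1 : W 0 ⊆ Finset.univ.biUnion Bad := by
          intro v hv
          obtain ⟨j, hj⟩ := hcon v hv
          exact Finset.mem_biUnion.2 ⟨j, Finset.mem_univ _, hj⟩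
        have h2 : ((W 0).card : ℝ) ≤ ∑ j, ((Bad j).card : ℝ) := by
          exact_mod_cast (Finset.card_le_card h1).trans Finset.card_biUnion_le
        have h3 : ∑ j, ((Bad j).card : ℝ) ≤ ∑ _j : Fin n, ((W 0).card : ℝ) / (n + 1) :=
          Finset.sum_le_sum fun j _ => (hb j).le
        have h4 : (0 : ℝ) < (W 0).card := hN.trans_le (hNW 0)
        simp only [Finset.sum_const, Finset.card_univ, Fintype.card_fin, nsmul_eq_mul] at h3
        have h5 : (n : ℝ) * ((W 0).card / (n + 1)) < (W 0).card := by
          rw [mul_div_assoc', div_lt_iff₀ (by positivity)]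
          nlinarith
        linarith
      have hvW : ∀ j, ε * (W j.succ).card < ((nbrsIn (K j) v (W j.succ)).card : ℝ) := by
        intro j
        have := hvb j
        simp only [hBad, Finset.mem_filter, hv, true_and, not_le] at this
        exact this
      rcases h V G (fun j => nbrsIn (K j) v (W j.succ)) (ε * N)
        (fun i j hij => (hW _ _ (fun h => hij (Fin.succ_injective _ h))).mono
          (nbrsIn_subset _ _ _) (nbrsIn_subset _ _ _)) (by positivity)
        (fun i => (mul_le_mul_of_nonneg_left (hNW i.succ) hε.le).trans (hvW i).le) with h1 | h1
      · obtain ⟨f, hf, hfa⟩ := h1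
        left
        refine ⟨Fin.cons v f, ?_, ?_⟩
        · intro i
          refine Fin.cases ?_ (fun j => ?_) i
          · simpa using hv
          · simpa using (mem_nbrsIn.1 (hf j)).1
        · intro i j
          refine Fin.cases ?_ (fun j' => ?_) j
          · intro hij
            exact absurd hij (Fin.not_lt_zero i)
          · refine Fin.cases ?_ (fun i' => ?_) i
            · intro _
              have := (mem_nbrsIn.1 (hf j')).2
              simp only [Fin.cons_zero, Fin.cons_succ]
              by_cases hH : H.Adj 0 j'.succ
              · simp only [hK, hH, if_true] at this
                simp [this, hH]
              · simp only [hK, hH, if_false, SimpleGraph.compl_adj] at this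
                simp [this.2, hH]
            · intro hij
              simp only [Fin.cons_succ]
              exact hfa i' j' (Fin.succ_lt_succ_iff.1 hij)
      · obtain ⟨i, j, hij, A, hA, B, hB, hAc, hBc, hd⟩ := h1
        have hle : min (1 / ((n : ℝ) + 1)) (ε * δ) * N ≤ δ * (ε * N) := by
          calc _ ≤ (ε * δ) * N := by gcongr; exact min_le_right _ _
            _ = _ := by ring
        exact Or.inr ⟨i.succ, j.succ, fun h => hij (Fin.succ_injective _ h), A,
          hA.trans (nbrsIn_subset _ _ _), B, hB.trans (nbrsIn_subset _ _ _),
          hle.trans hAc, hle.trans hBc, hd⟩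

open scoped Classical in
/-- Every set of vertices that is not too small contains two disjoint parts, of at least a
`δ`-fraction each, between which `G` or its complement is `ε`-sparse. -/
def HasSparsePairs {V : Type u} (ε δ : ℝ) (G : SimpleGraph V) : Prop :=
  ∀ X : Finset V, 1 ≤ δ * X.card → ∃ A ⊆ X, ∃ B ⊆ X, Disjoint A B ∧
    δ * X.card ≤ A.card ∧ δ * X.card ≤ B.card ∧
    ((∀ a ∈ A, ((nbrsIn G a B).card : ℝ) ≤ ε * B.card) ∨
      ∀ a ∈ A, ((nbrsIn Gᶜ a B).card : ℝ) ≤ ε * B.card)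

/-- A finset of cardinality at least `n * q` contains `n` disjoint subsets of cardinality `q`. -/
theorem Finset.exists_disjoint_family {V : Type u} (n q : ℕ) : ∀ (X : Finset V), n * q ≤ X.card →
    ∃ W : Fin n → Finset V, (∀ i, W i ⊆ X) ∧ (∀ i, (W i).card = q) ∧
      ∀ i j, i ≠ j → Disjoint (W i) (W j) := by
  classical
  induction n with
  | zero => exact fun X _ => ⟨Fin.elim0, fun i => i.elim0, fun i => i.elim0, fun i => i.elim0⟩
  | succ n ih =>
    intro X hX
    rw [add_mul, one_mul] at hX
    obtain ⟨Y, hY, hYc⟩ := Finset.exists_subset_card_eq (show q ≤ X.card by omega)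
    obtain ⟨W, h1, h2, h3⟩ := ih (X \ Y) (by rw [Finset.card_sdiff_of_subset hY]; omega)
    have hd : ∀ i, Disjoint Y (W i) := fun i =>
      (Finset.disjoint_sdiff).mono_right (h1 i)
    refine ⟨Fin.cons Y W, ?_, ?_, ?_⟩
    · exact Fin.cases (by simpa using hY) fun i => by simpa using (h1 i).trans Finset.sdiff_subset
    · exact Fin.cases (by simpa using hYc) fun i => by simpa using h2 i
    · intro i j
      refine Fin.cases ?_ (fun i' => ?_) i <;> refine Fin.cases ?_ (fun j' => ?_) j
      · intro h; exact absurd rfl h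
      · intro _; simpa using hd j'
      · intro _; simpa using (hd i').symm
      · intro h; simpa using h3 i' j' (fun e => h (by rw [e]))

/-- Cut `X` into `n` blocks of equal size, one for each vertex of `H`. A transversal copy is
excluded, so two of the blocks contain a sparse pair. The factor 2 in `δ / (2 * n)` absorbs the
rounding of the block size. -/
theorem exists_hasSparsePairs {U : Type v} [Fintype U] [Nonempty U] (H : SimpleGraph U) {ε : ℝ}
    (hε : 0 < ε) :
    ∃ δ : ℝ, 0 < δ ∧ δ ≤ 1 ∧ ∀ (V : Type u) (G : SimpleGraph V), ¬ H.IsIndContained G →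
      HasSparsePairs ε δ G := by
  classical
  set n := Fintype.card U with hn
  have hn0 : 0 < n := Fintype.card_pos
  let e : U ≃ Fin n := Fintype.equivFin U
  obtain ⟨δ, hδ, hδ1, h⟩ := exists_transversal_or_sparse_pair.{u} n (H.comap e.symm) ε hε
  have hn0' : (0 : ℝ) < n := by exact_mod_cast hn0
  have hn1 : (1 : ℝ) ≤ n := by exact_mod_cast hn0
  refine ⟨δ / (2 * n), by positivity, ?_, fun V G hG X hX => ?_⟩
  · rw [div_le_one (by positivity)]; linarith
  set q := X.card / n with hq
  have hXn : (2 * n : ℝ) ≤ X.card := by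
    rw [div_mul_eq_mul_div, le_div_iff₀ (by positivity)] at hX
    nlinarith [(Nat.cast_nonneg X.card : (0 : ℝ) ≤ X.card)]
  have hXn' : 2 * n ≤ X.card := by exact_mod_cast hXn
  obtain ⟨W, hWX, hWc, hWd⟩ := Finset.exists_disjoint_family n q X (by
    rw [mul_comm]; exact Nat.div_mul_le_self _ _)
  have hqlow : (X.card : ℝ) / (2 * n) ≤ q := by
    rw [div_le_iff₀ (by positivity)]
    have h1 : X.card < (q + 1) * n := by
      have := Nat.lt_div_mul_add hn0 (a := X.card); rw [← hq] at this; linarith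
    have h2 : 1 ≤ q := by
      rw [hq, Nat.le_div_iff_mul_le hn0]; omega
    have h3 : X.card ≤ q * (2 * n) := by nlinarith
    exact_mod_cast h3
  have hpos : (0 : ℝ) < X.card / (2 * n) := by
    have : (0 : ℝ) < X.card := by linarith
    positivity
  rcases h V G W (X.card / (2 * n)) hWd hpos (fun i => by rw [hWc]; exact hqlow) with h1 | h1
  · exfalso
    obtain ⟨f, hf, hfa⟩ := h1
    have hinj : Function.Injective f := by
      intro i j hij
      by_contra hne
      exact Finset.disjoint_left.1 (hWd i j hne) (hf i) (hij ▸ hf j)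
    have hadj : ∀ i j, G.Adj (f i) (f j) ↔ H.Adj (e.symm i) (e.symm j) := by
      intro i j
      rcases lt_trichotomy i j with hlt | heq | hgt
      · exact hfa i j hlt
      · subst heq; simp
      · rw [G.adj_comm, H.adj_comm]; exact hfa j i hgt
    refine hG ⟨⟨⟨fun x => f (e x), fun x y hxy => e.injective (hinj hxy)⟩, ?_⟩⟩
    intro x y
    change G.Adj (f (e x)) (f (e y)) ↔ H.Adj x y
    rw [hadj, e.symm_apply_apply, e.symm_apply_apply]
  · obtain ⟨i, j, hij, A, hA, B, hB, hAc, hBc, hd⟩ := h1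
    have hre : δ / (2 * n) * X.card = δ * (X.card / (2 * n)) := by ring
    exact ⟨A, hA.trans (hWX i), B, hB.trans (hWX j), (hWd i j hij).mono hA hB, by rw [hre]; exact hAc,
      by rw [hre]; exact hBc, hd⟩

-- Double counting and Markov's inequality: at most half of `B` can exceed twice the average density
-- towards `A`.
open scoped Classical in
theorem exists_sparse_part {V : Type u} (K : SimpleGraph V) (A B : Finset V) {ε : ℝ} (hε : 0 < ε)
    (h : ∀ a ∈ A, ((nbrsIn K a B).card : ℝ) ≤ ε * B.card) :
    ∃ B' ⊆ B, (B.card : ℝ) ≤ 2 * B'.card ∧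
      ∀ b ∈ B', ((nbrsIn K b A).card : ℝ) ≤ 2 * ε * A.card := by
  rcases A.eq_empty_or_nonempty with rfl | hA
  · exact ⟨B, subset_rfl, by linarith [(Nat.cast_nonneg B.card : (0 : ℝ) ≤ B.card)], by simp [nbrsIn]⟩
  have hA' : (0 : ℝ) < A.card := by exact_mod_cast hA.card_pos
  set p : V → Prop := fun b => ((nbrsIn K b A).card : ℝ) ≤ 2 * ε * A.card with hp
  refine ⟨B.filter p, Finset.filter_subset _ _, ?_, fun b hb => (Finset.mem_filter.1 hb).2⟩
  have hdc : ∑ b ∈ B, ((nbrsIn K b A).card : ℝ) = ∑ a ∈ A, ((nbrsIn K a B).card : ℝ) := by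
    exact sum_card_nbrsIn_comm K A B
  have h1 : ∑ a ∈ A, ((nbrsIn K a B).card : ℝ) ≤ A.card * (ε * B.card) := by
    rw [← nsmul_eq_mul]
    exact Finset.sum_le_card_nsmul _ _ _ h
  have h2 : ((B.filter fun b => ¬ p b).card : ℝ) * (2 * ε * A.card) ≤
      ∑ b ∈ B.filter (fun b => ¬ p b), ((nbrsIn K b A).card : ℝ) := by
    rw [← nsmul_eq_mul]
    refine Finset.card_nsmul_le_sum _ _ _ fun b hb => ?_
    exact (not_le.1 (Finset.mem_filter.1 hb).2).le
  have h3 : ∑ b ∈ B.filter (fun b => ¬ p b), ((nbrsIn K b A).card : ℝ) ≤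
      ∑ b ∈ B, ((nbrsIn K b A).card : ℝ) :=
    Finset.sum_le_sum_of_subset_of_nonneg (Finset.filter_subset _ _) fun _ _ _ => Nat.cast_nonneg _
  have h4 : ((B.filter fun b => ¬ p b).card : ℝ) * (2 * ε * A.card) ≤ A.card * (ε * B.card) := by
    linarith
  have h5 : 2 * ((B.filter fun b => ¬ p b).card : ℝ) ≤ B.card := by
    have : (2 * ((B.filter fun b => ¬ p b).card : ℝ)) * (ε * A.card) ≤ B.card * (ε * A.card) := by
      linarith
    exact le_of_mul_le_mul_right this (by positivity)
  have h6 : ((B.filter p).card : ℝ) + (B.filter fun b => ¬ p b).card = B.card := by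
    exact_mod_cast Finset.card_filter_add_card_filter_not p
  linarith

open scoped Classical in
/-- The number of ordered adjacent pairs in `Y`. -/
noncomputable def adjPairs {V : Type u} (K : SimpleGraph V) (Y : Finset V) : ℝ :=
  ∑ a ∈ Y, ((nbrsIn K a Y).card : ℝ)

theorem adjPairs_le_sq {V : Type u} (K : SimpleGraph V) (Y : Finset V) :
    adjPairs K Y ≤ (Y.card : ℝ) ^ 2 := by
  classical
  have : adjPairs K Y ≤ Y.card • (Y.card : ℝ) := by
    refine Finset.sum_le_card_nsmul _ _ _ fun a _ => ?_
    exact_mod_cast Finset.card_le_card (nbrsIn_subset _ _ _)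
  rwa [nsmul_eq_mul, ← sq] at this

open scoped Classical in
theorem adjPairs_union {V : Type u} (K : SimpleGraph V) (A B : Finset V) (hAB : Disjoint A B)
    {c : ℝ} (h : ∀ b ∈ B, ((nbrsIn K b A).card : ℝ) ≤ c) :
    adjPairs K (A ∪ B) ≤ adjPairs K A + adjPairs K B + 2 * (B.card * c) := by
  have hs : ∀ a, ((nbrsIn K a (A ∪ B)).card : ℝ) =
      (nbrsIn K a A).card + (nbrsIn K a B).card := by
    intro a
    have : nbrsIn K a (A ∪ B) = nbrsIn K a A ∪ nbrsIn K a B := by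
      ext x; simp only [mem_nbrsIn, Finset.mem_union, or_and_right]
    rw [this, Finset.card_union_of_disjoint (hAB.mono (nbrsIn_subset _ _ _) (nbrsIn_subset _ _ _))]
    push_cast; rfl
  have hdc : ∑ b ∈ B, ((nbrsIn K b A).card : ℝ) = ∑ a ∈ A, ((nbrsIn K a B).card : ℝ) := by
    exact sum_card_nbrsIn_comm K A B
  have h1 : ∑ b ∈ B, ((nbrsIn K b A).card : ℝ) ≤ B.card * c := by
    rw [← nsmul_eq_mul]
    exact Finset.sum_le_card_nsmul _ _ _ h
  unfold adjPairs
  rw [Finset.sum_union hAB]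
  simp only [hs, Finset.sum_add_distrib]
  linarith

/-- Doubling step: if one of the two graphs is sparse from `A` to `B`, dense blocks in `A` and `B`
combine to a twice larger one. -/
theorem exists_sparse_or_cosparse_set (N : ℕ) : ∀ (s t : ℕ), s + t = N → ∀ {ε δ : ℝ}, 0 < ε →
    0 < δ → δ ≤ 1 → ∃ η : ℝ, 0 < η ∧ η ≤ 1 ∧ ∀ (V : Type u) (G : SimpleGraph V),
      HasSparsePairs ε δ G → ∀ (X : Finset V) (m : ℕ), (m : ℝ) ≤ η * X.card →
      (∃ Y ⊆ X, Y.card = 2 ^ s * m ∧ adjPairs G Y ≤ ((1 / 2) ^ s + 2 * ε) * (Y.card : ℝ) ^ 2) ∨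
      (∃ Y ⊆ X, Y.card = 2 ^ t * m ∧ adjPairs Gᶜ Y ≤ ((1 / 2) ^ t + 2 * ε) * (Y.card : ℝ) ^ 2) := by
  classical
  have base : ∀ (V : Type u) (G : SimpleGraph V) (ε : ℝ) (X : Finset V) (m : ℕ), 0 < ε →
      (m : ℝ) ≤ 1 * X.card →
      ∃ Y ⊆ X, Y.card = 2 ^ 0 * m ∧ adjPairs G Y ≤ ((1 / 2) ^ 0 + 2 * ε) * (Y.card : ℝ) ^ 2 := by
    intro V G ε X m hε hm
    rw [one_mul] at hm
    obtain ⟨Y, hY, hYc⟩ := Finset.exists_subset_card_eq (show m ≤ X.card by exact_mod_cast hm)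
    refine ⟨Y, hY, by simpa using hYc, (adjPairs_le_sq G Y).trans ?_⟩
    have : (0 : ℝ) ≤ 2 * ε * (Y.card : ℝ) ^ 2 := by positivity
    linarith
  induction N with
  | zero =>
    intro s t hst ε δ hε _ _
    obtain ⟨rfl, rfl⟩ : s = 0 ∧ t = 0 := by omega
    exact ⟨1, one_pos, le_rfl, fun V G _ X m hm => Or.inl (base V G ε X m hε hm)⟩
  | succ N ih =>
    intro s t hst ε δ hε hδ hδ1
    rcases Nat.eq_zero_or_pos s with rfl | hs
    · exact ⟨1, one_pos, le_rfl, fun V G _ X m hm => Or.inl (base V G ε X m hε hm)⟩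
    rcases Nat.eq_zero_or_pos t with rfl | ht
    · exact ⟨1, one_pos, le_rfl, fun V G _ X m hm => Or.inr (base V Gᶜ ε X m hε hm)⟩
    obtain ⟨s, rfl⟩ := Nat.exists_eq_succ_of_ne_zero hs.ne'
    obtain ⟨t, rfl⟩ := Nat.exists_eq_succ_of_ne_zero ht.ne'
    obtain ⟨η₁, hη₁, hη₁1, h₁⟩ := ih s (t + 1) (by omega) hε hδ hδ1
    obtain ⟨η₂, hη₂, hη₂1, h₂⟩ := ih (s + 1) t (by omega) hε hδ hδ1
    -- the step for a sparse pair
    have step : ∀ (s t : ℕ) (η' : ℝ), 0 < η' → ∀ (V : Type u) (G : SimpleGraph V) (A B : Finset V)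
        (m : ℕ), (m : ℝ) ≤ η' / 2 * A.card → (m : ℝ) ≤ η' / 2 * B.card → Disjoint A B →
        (∀ a ∈ A, ((nbrsIn G a B).card : ℝ) ≤ ε * B.card) →
        (∀ (X : Finset V), (m : ℝ) ≤ η' * X.card →
          (∃ Y ⊆ X, Y.card = 2 ^ s * m ∧
            adjPairs G Y ≤ ((1 / 2) ^ s + 2 * ε) * (Y.card : ℝ) ^ 2) ∨
          (∃ Y ⊆ X, Y.card = 2 ^ (t + 1) * m ∧
            adjPairs Gᶜ Y ≤ ((1 / 2) ^ (t + 1) + 2 * ε) * (Y.card : ℝ) ^ 2)) →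
        (∃ Y ⊆ A ∪ B, Y.card = 2 ^ (s + 1) * m ∧
          adjPairs G Y ≤ ((1 / 2) ^ (s + 1) + 2 * ε) * (Y.card : ℝ) ^ 2) ∨
        (∃ Y ⊆ A ∪ B, Y.card = 2 ^ (t + 1) * m ∧
          adjPairs Gᶜ Y ≤ ((1 / 2) ^ (t + 1) + 2 * ε) * (Y.card : ℝ) ^ 2) := by
      intro s t η' hη' V G A B m hmA hmB hAB hsp hX
      have hAc : (0 : ℝ) ≤ A.card := Nat.cast_nonneg _
      rcases hX A (by nlinarith) with ⟨Y₁, hY₁, hY₁c, hY₁e⟩ | ⟨Y, hY, hYc, hYe⟩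
      swap
      · exact Or.inr ⟨Y, hY.trans Finset.subset_union_left, hYc, hYe⟩
      obtain ⟨B', hB', hB'c, hB'd⟩ := exists_sparse_part G Y₁ B hε fun a ha => hsp a (hY₁ ha)
      rcases hX B' (by nlinarith) with ⟨Y₂, hY₂, hY₂c, hY₂e⟩ | ⟨Y, hY, hYc, hYe⟩
      swap
      · exact Or.inr ⟨Y, (hY.trans hB').trans Finset.subset_union_right, hYc, hYe⟩
      have hdis : Disjoint Y₁ Y₂ := hAB.mono hY₁ (hY₂.trans hB')
      have hc : (Y₁ ∪ Y₂).card = 2 ^ (s + 1) * m := by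
        rw [Finset.card_union_of_disjoint hdis, hY₁c, hY₂c]; ring
      refine Or.inl ⟨Y₁ ∪ Y₂, Finset.union_subset_union hY₁ (hY₂.trans hB'), hc, ?_⟩
      refine (adjPairs_union G Y₁ Y₂ hdis fun b hb => hB'd b (hY₂ hb)).trans ?_
      rw [hc]
      rw [hY₁c] at hY₁e
      rw [hY₂c] at hY₂e
      rw [hY₁c, hY₂c]
      push_cast at hY₁e hY₂e ⊢
      -- With `M = 2 ^ s * m`, the two halves contribute `2 * ((1 / 2) ^ s + 2 * ε) * M ^ 2` and the
      -- cross pairs `4 * ε * M ^ 2`. The sum is exactly the bound for a set of size `2 * M`: the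
      -- error `2 * ε` reproduces itself.
      have e1 : ((1 : ℝ) / 2) ^ (s + 1) = (1 / 2) * (1 / 2) ^ s := by ring
      have e2 : ((2 : ℝ) ^ (s + 1) * m) = 2 * (2 ^ s * m) := by ring
      rw [e1, e2]
      nlinarith [hY₁e, hY₂e]
    -- The first term leaves room to halve `B`; the second ensures `1 ≤ δ * X.card` as soon as `m`
    -- is positive, as `HasSparsePairs` demands.
    refine ⟨min (δ * (min η₁ η₂ / 2)) (δ / 2), by positivity, ?_, ?_⟩
    · exact (min_le_right _ _).trans (by linarith)
    intro V G hG X m hm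
    rcases Nat.eq_zero_or_pos m with rfl | hm0
    · exact Or.inl ⟨∅, by simp, by simp, by simp [adjPairs]⟩
    have hm1 : (1 : ℝ) ≤ m := by exact_mod_cast hm0
    have hXc : (0 : ℝ) ≤ X.card := Nat.cast_nonneg _
    have hmη : (m : ℝ) ≤ min η₁ η₂ / 2 * (δ * X.card) := by
      refine hm.trans ?_
      calc _ ≤ (δ * (min η₁ η₂ / 2)) * X.card := by gcongr; exact min_le_left _ _
        _ = _ := by ring
    obtain ⟨A, hA, B, hB, hAB, hAc, hBc, hd⟩ := hG X (by
      have : (m : ℝ) ≤ δ / 2 * X.card := hm.trans (by gcongr; exact min_le_right _ _)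
      linarith)
    have hmin : (0 : ℝ) < min η₁ η₂ := lt_min hη₁ hη₂
    have hmA : ∀ C : Finset V, δ * X.card ≤ C.card → ∀ η', min η₁ η₂ ≤ η' → (m : ℝ) ≤ η' / 2 * C.card := by
      intro C hC η' hη'
      refine hmη.trans ?_
      have h0 : 0 ≤ δ * (X.card : ℝ) := by positivity
      have h1 : 0 < η' := hmin.trans_le hη'
      gcongr
    have hsub : A ∪ B ⊆ X := Finset.union_subset hA hB
    rcases hd with hd | hd
    · rcases step s t η₁ hη₁ V G A B m (hmA A hAc _ (min_le_left _ _))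
        (hmA B hBc _ (min_le_left _ _)) hAB hd (fun X hX => h₁ V G hG X m hX) with
        ⟨Y, h, h'⟩ | ⟨Y, h, h'⟩
      · exact Or.inl ⟨Y, h.trans hsub, h'⟩
      · exact Or.inr ⟨Y, h.trans hsub, h'⟩
    · rcases step t s η₂ hη₂ V Gᶜ A B m (hmA A hAc _ (min_le_right _ _))
        (hmA B hBc _ (min_le_right _ _)) hAB hd (fun X hX => by
          rw [compl_compl]; exact (h₂ V G hG X m hX).symm) with
        ⟨Y, h, h'⟩ | ⟨Y, h, h'⟩
      · exact Or.inr ⟨Y, h.trans hsub, h'⟩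
      · rw [compl_compl] at h'
        exact Or.inl ⟨Y, h.trans hsub, h'⟩

open scoped Classical in
/-- Few adjacent pairs give a large subset of small maximum degree. -/
theorem exists_small_degree_subset {V : Type u} (K : SimpleGraph V) (Y : Finset V) {ε : ℝ}
    (hε : 0 < ε) (h : adjPairs K Y ≤ ε * (Y.card : ℝ) ^ 2) :
    ∃ X ⊆ Y, (Y.card : ℝ) ≤ 2 * X.card ∧
      ∀ v ∈ X, ((nbrsIn K v X).card : ℝ) ≤ 4 * ε * X.card := by
  rcases Y.eq_empty_or_nonempty with rfl | hY
  · exact ⟨∅, subset_rfl, by simp, by simp⟩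
  have hY' : (0 : ℝ) < Y.card := by exact_mod_cast hY.card_pos
  set p : V → Prop := fun b => ((nbrsIn K b Y).card : ℝ) ≤ 2 * ε * Y.card with hp
  have h2 : ((Y.filter fun b => ¬ p b).card : ℝ) * (2 * ε * Y.card) ≤ adjPairs K Y := by
    rw [← nsmul_eq_mul]
    refine le_trans (Finset.card_nsmul_le_sum (Y.filter fun b => ¬ p b)
      (fun b => ((nbrsIn K b Y).card : ℝ)) _ fun b hb => ?_)
      (Finset.sum_le_sum_of_subset_of_nonneg (Finset.filter_subset _ _) fun _ _ _ => Nat.cast_nonneg _)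
    exact (not_le.1 (Finset.mem_filter.1 hb).2).le
  have h5 : 2 * ((Y.filter fun b => ¬ p b).card : ℝ) ≤ Y.card := by
    have : (2 * ((Y.filter fun b => ¬ p b).card : ℝ)) * (ε * Y.card) ≤ Y.card * (ε * Y.card) := by
      nlinarith
    exact le_of_mul_le_mul_right this (by positivity)
  have h6 : ((Y.filter p).card : ℝ) + (Y.filter fun b => ¬ p b).card = Y.card := by
    exact_mod_cast Finset.card_filter_add_card_filter_not p
  have h7 : (Y.card : ℝ) ≤ 2 * (Y.filter p).card := by linarith
  refine ⟨Y.filter p, Finset.filter_subset _ _, h7, fun v hv => ?_⟩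
  have h8 : ((nbrsIn K v Y).card : ℝ) ≤ 2 * ε * Y.card := (Finset.mem_filter.1 hv).2
  have h9 : ((nbrsIn K v (Y.filter p)).card : ℝ) ≤ (nbrsIn K v Y).card := by
    exact_mod_cast Finset.card_le_card (nbrsIn_mono _ _ (Finset.filter_subset _ _))
  nlinarith

open scoped Classical in
/-- Rödl's theorem: a graph without an induced copy of `H` has a linear-sized set of vertices that
induces a graph of small maximum degree, in the graph or in its complement. -/
theorem exists_sparse_or_cosparse {U : Type v} [Fintype U] [Nonempty U] (H : SimpleGraph U) {ε : ℝ}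
    (hε : 0 < ε) :
    ∃ δ : ℝ, 0 < δ ∧ ∀ (V : Type u) [Fintype V] (G : SimpleGraph V), ¬ H.IsIndContained G →
      1 ≤ δ * Fintype.card V → ∃ X : Finset V, δ * Fintype.card V ≤ X.card ∧
        ((∀ v ∈ X, ((nbrsIn G v X).card : ℝ) ≤ ε * X.card) ∨
          ∀ v ∈ X, ((nbrsIn Gᶜ v X).card : ℝ) ≤ ε * X.card) := by
  -- The density becomes at most `ε / 8 + 2 * (ε / 16) = ε / 4`, and passing from average to maximum
  -- degree costs a factor 4.
  obtain ⟨s, hs⟩ := exists_pow_lt_of_lt_one (show 0 < ε / 8 by positivity)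
    (show (1 / 2 : ℝ) < 1 by norm_num)
  obtain ⟨δ, hδ, hδ1, h⟩ := exists_hasSparsePairs.{u} H (ε := ε / 16) (by positivity)
  obtain ⟨η, hη, hη1, h'⟩ := exists_sparse_or_cosparse_set.{u} (s + s) s s rfl
    (ε := ε / 16) (by positivity) hδ hδ1
  refine ⟨η / 4, by positivity, fun V _ G hG hV => ?_⟩
  have hV' : (Finset.univ : Finset V).card = Fintype.card V := Finset.card_univ
  set m := ⌊η * Fintype.card V⌋₊ with hm
  have hm0 : (0 : ℝ) ≤ η * Fintype.card V := by positivity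
  have hm1 : η * Fintype.card V < m + 1 := Nat.lt_floor_add_one _
  have key : ∀ (K : SimpleGraph V) (Y : Finset V), Y.card = 2 ^ s * m →
      adjPairs K Y ≤ ((1 / 2) ^ s + 2 * (ε / 16)) * (Y.card : ℝ) ^ 2 →
      ∃ X : Finset V, η / 4 * Fintype.card V ≤ X.card ∧
        ∀ v ∈ X, ((nbrsIn K v X).card : ℝ) ≤ ε * X.card := by
    intro K Y hYc hYe
    obtain ⟨X, hX, hXc, hXd⟩ := exists_small_degree_subset K Y (ε := ε / 4) (by positivity)
      (hYe.trans (by gcongr; linarith))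
    refine ⟨X, ?_, fun v hv => (hXd v hv).trans (by linarith)⟩
    have h2 : (m : ℝ) ≤ Y.card := by
      rw [hYc]; push_cast
      have : (1 : ℝ) ≤ 2 ^ s := one_le_pow₀ (by norm_num)
      nlinarith [(Nat.cast_nonneg m : (0 : ℝ) ≤ m)]
    linarith
  rcases h' V G (h V G hG) Finset.univ m (by
    rw [hV']; exact Nat.floor_le hm0) with ⟨Y, _, hYc, hYe⟩ | ⟨Y, _, hYc, hYe⟩
  · obtain ⟨X, h1, h2⟩ := key G Y hYc hYe
    exact ⟨X, h1, Or.inl h2⟩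
  · obtain ⟨X, h1, h2⟩ := key Gᶜ Y hYc hYe
    exact ⟨X, h1, Or.inr h2⟩

end Rodl

/-! ### Growing sets and induced paths in coherent graphs. -/

section Growth

variable {V : Type u}

open scoped Classical in
/-- The vertices of `P` with a neighbour in `D`. -/
noncomputable def hits (G : SimpleGraph V) (D P : Finset V) : Finset V :=
  P.filter fun p => ∃ d ∈ D, G.Adj d p

theorem mem_hits {G : SimpleGraph V} {D P : Finset V} {p : V} :
    p ∈ hits G D P ↔ p ∈ P ∧ ∃ d ∈ D, G.Adj d p := by
  classical
  simp [hits]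

theorem hits_subset (G : SimpleGraph V) (D P : Finset V) : hits G D P ⊆ P :=
  fun _ h => (mem_hits.1 h).1

theorem hits_mono {G : SimpleGraph V} {D D' : Finset V} (h : D ⊆ D') (P : Finset V) :
    hits G D P ⊆ hits G D' P := fun _ hp =>
  let ⟨hp, d, hd, ha⟩ := mem_hits.1 hp
  mem_hits.2 ⟨hp, d, h hd, ha⟩

/-- Vertex neighbourhoods are small, and any two disjoint sets that are not small are joined by
an edge. -/
structure Coherent [Fintype V] (κ : ℝ) (G : SimpleGraph V) : Prop where
  deg : ∀ v, ((nbrsIn G v Finset.univ).card : ℝ) ≤ κ * Fintype.card V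
  edge : ∀ A B : Finset V, Disjoint A B → κ * Fintype.card V ≤ A.card →
    κ * Fintype.card V ≤ B.card → ∃ a ∈ A, ∃ b ∈ B, G.Adj a b

theorem Coherent.mono [Fintype V] {κ κ' : ℝ} {G : SimpleGraph V} (h : Coherent κ G) (hκ : κ ≤ κ') :
    Coherent κ' G := by
  have h1 : κ * Fintype.card V ≤ κ' * Fintype.card V := by gcongr
  exact ⟨fun v => (h.deg v).trans h1,
    fun A B hAB hA hB => h.edge A B hAB (h1.trans hA) (h1.trans hB)⟩

/-- Every partition of `S` into two nonempty parts is crossed by an edge. -/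
def CutConnected [DecidableEq V] (G : SimpleGraph V) (S : Finset V) : Prop :=
  ∀ A ⊆ S, A.Nonempty → (S \ A).Nonempty → ∃ a ∈ A, ∃ b ∈ S \ A, G.Adj a b

/-- The first `k + 1` terms of `q` are the vertices of an induced path. -/
def IsInducedPath (G : SimpleGraph V) (q : ℕ → V) (k : ℕ) : Prop :=
  ∀ i ≤ k, ∀ j ≤ k, (q i = q j → i = j) ∧ (G.Adj (q i) (q j) ↔ i + 1 = j ∨ j + 1 = i)

variable [DecidableEq V] {G : SimpleGraph V}

theorem CutConnected.insert {S : Finset V} (hS : CutConnected G S) {x y : V} (hy : y ∈ S)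
    (hxy : G.Adj x y) : CutConnected G (insert x S) := by
  intro A hA hne hne'
  by_cases hxS : x ∈ S
  · rw [Finset.insert_eq_of_mem hxS] at hA hne' ⊢
    exact hS A hA hne hne'
  by_cases hxA : x ∈ A
  · by_cases hyA : y ∈ A
    · obtain ⟨a, ha, b, hb, hab⟩ := hS (A ∩ S) Finset.inter_subset_right ⟨y, by simp [hyA, hy]⟩ (by
        obtain ⟨z, hz⟩ := hne'
        refine ⟨z, ?_⟩
        simp only [Finset.mem_sdiff, Finset.mem_insert, Finset.mem_inter] at hz ⊢
        rcases hz with ⟨rfl | h, h'⟩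
        · exact absurd hxA h'
        · exact ⟨h, fun h => h' h.1⟩)
      simp only [Finset.mem_sdiff, Finset.mem_inter] at ha hb
      exact ⟨a, ha.1, b, by simp [hb.1]; exact fun h => hb.2 ⟨h, hb.1⟩, hab⟩
    · exact ⟨x, hxA, y, by simp [hy, hyA], hxy⟩
  · have hAS : A ⊆ S := fun a ha => (Finset.mem_insert.1 (hA ha)).resolve_left fun h => hxA (h ▸ ha)
    by_cases hyA : y ∈ A
    · exact ⟨y, hyA, x, by simp [hxA], hxy.symm⟩
    · obtain ⟨a, ha, b, hb, hab⟩ := hS A hAS hne ⟨y, by simp [hy, hyA]⟩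
      simp only [Finset.mem_sdiff] at hb
      exact ⟨a, ha, b, by simp [hb.1, hb.2], hab⟩

theorem CutConnected.preconnected {S : Finset V} (hS : CutConnected G S) :
    (G.induce (S : Set V)).Preconnected := by
  classical
  intro x y
  by_contra hxy
  set A : Finset V := S.filter fun z => ∃ h : z ∈ S, (G.induce (S : Set V)).Reachable x ⟨z, h⟩ with hA
  obtain ⟨a, ha, b, hb, hab⟩ := hS A (Finset.filter_subset _ _)
    ⟨x, Finset.mem_filter.2 ⟨x.2, x.2, SimpleGraph.Reachable.refl _⟩⟩
    ⟨y, by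
      refine Finset.mem_sdiff.2 ⟨y.2, fun h => ?_⟩
      obtain ⟨_, _, h⟩ := Finset.mem_filter.1 h
      exact hxy h⟩
  obtain ⟨_, haS, har⟩ := Finset.mem_filter.1 ha
  rw [Finset.mem_sdiff] at hb
  refine hb.2 (Finset.mem_filter.2 ⟨hb.1, hb.1, har.trans (SimpleGraph.Adj.reachable ?_)⟩)
  exact hab

/-- In a connected set, a vertex far from another one, as witnessed by a Lipschitz function, is an
end of a long induced path. -/
theorem CutConnected.exists_inducedPath {S : Finset V} (hS : CutConnected G S) {p r : V}
    (hp : p ∈ S) (hr : r ∈ S) {k : ℕ} (w : V → ℕ)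
    (hw : ∀ x ∈ S, ∀ y ∈ S, G.Adj x y → w y ≤ w x + 1) (hwp : w p = 0) (hwr : w r = k) :
    ∃ q : ℕ → V, q 0 = p ∧ (∀ i, q i ∈ S) ∧ IsInducedPath G q k := by
  set H := G.induce (S : Set V) with hH
  have hlip : ∀ {x y : (S : Set V)} (W : H.Walk x y), w y ≤ w x + W.length := by
    intro x y W
    induction W with
    | nil => simp
    | @cons a b c h W ih =>
      have := hw a a.2 b b.2 h
      rw [SimpleGraph.Walk.length_cons]
      omega
  obtain ⟨W, hW⟩ := (hS.preconnected ⟨p, hp⟩ ⟨r, hr⟩).exists_walk_length_eq_dist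
  set L := W.length with hL
  have hkL : k ≤ L := by
    have := hlip W
    simp only [hwp, hwr] at this
    omega
  -- On a shortest walk the distance to the end determines the position, and it differs by at most
  -- one between adjacent vertices; so the walk is an induced path.
  have hdist : ∀ i ≤ L, H.dist (W.getVert i) ⟨r, hr⟩ = L - i := by
    intro i hi
    have h1 : H.dist (W.getVert i) ⟨r, hr⟩ ≤ L - i := by
      have := SimpleGraph.dist_le (W.drop i)
      rwa [SimpleGraph.Walk.drop_length] at this
    have h2 : H.dist ⟨p, hp⟩ (W.getVert i) ≤ i := by
      have := SimpleGraph.dist_le (W.take i)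
      rw [SimpleGraph.Walk.take_length] at this
      exact this.trans (min_le_left _ _)
    have h3 : H.dist ⟨p, hp⟩ ⟨r, hr⟩ ≤ H.dist ⟨p, hp⟩ (W.getVert i) + H.dist (W.getVert i) ⟨r, hr⟩ :=
      SimpleGraph.Reachable.dist_triangle_left (hS.preconnected _ _) _
    rw [← hW] at h3
    omega
  refine ⟨fun i => (W.getVert i : V), by simp, fun i => (W.getVert i).2, ?_⟩
  intro i hi j hj
  have di := hdist i (hi.trans hkL)
  have dj := hdist j (hj.trans hkL)
  refine ⟨fun h => ?_, fun h => ?_, fun h => ?_⟩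
  · rw [Subtype.ext h, dj] at di
    omega
  · have hadj : H.Adj (W.getVert i) (W.getVert j) := h
    have h1 : H.dist (W.getVert i) ⟨r, hr⟩ ≤ H.dist (W.getVert j) ⟨r, hr⟩ + 1 := by
      have := SimpleGraph.Reachable.dist_triangle_left hadj.reachable (⟨r, hr⟩ : (S : Set V))
      rw [SimpleGraph.dist_eq_one_iff_adj.2 hadj] at this
      omega
    have h2 : H.dist (W.getVert j) ⟨r, hr⟩ ≤ H.dist (W.getVert i) ⟨r, hr⟩ + 1 := by
      have := SimpleGraph.Reachable.dist_triangle_left hadj.symm.reachable (⟨r, hr⟩ : (S : Set V))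
      rw [SimpleGraph.dist_eq_one_iff_adj.2 hadj.symm] at this
      omega
    have hne : i ≠ j := by
      rintro rfl
      exact hadj.ne rfl
    omega
  · rcases h with rfl | rfl
    · exact W.adj_getVert_succ (by omega)
    · exact (W.adj_getVert_succ (by omega)).symm

variable [Fintype V] {κ : ℝ}

theorem Coherent.card_hits_insert (hG : Coherent κ G) (x : V) (D P : Finset V) :
    ((hits G (insert x D) P).card : ℝ) ≤ (hits G D P).card + κ * Fintype.card V := by
  have h : hits G (insert x D) P ⊆ hits G D P ∪ nbrsIn G x Finset.univ := by
    intro p hp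
    obtain ⟨hp, d, hd, ha⟩ := mem_hits.1 hp
    rcases Finset.mem_insert.1 hd with rfl | hd
    · exact Finset.mem_union_right _ (mem_nbrsIn.2 ⟨Finset.mem_univ _, ha⟩)
    · exact Finset.mem_union_left _ (mem_hits.2 ⟨hp, d, hd, ha⟩)
  have h1 : ((hits G (insert x D) P).card : ℝ) ≤ (hits G D P).card +
      (nbrsIn G x Finset.univ).card := by
    exact_mod_cast (Finset.card_le_card h).trans (Finset.card_union_le _ _)
  linarith [hG.deg x]

theorem Coherent.card_hits_le (hG : Coherent κ G) (D P : Finset V) :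
    ((hits G D P).card : ℝ) ≤ D.card * (κ * Fintype.card V) := by
  induction D using Finset.induction_on with
  | empty => simp [hits]
  | insert x D hx ih =>
    rw [Finset.card_insert_of_notMem hx]
    push_cast
    linarith [hG.card_hits_insert x D P]

/-- The part of `P` that `Z` misses has no edge to `Z`, so coherence makes it small. -/
theorem Coherent.card_lt_hits_add (hG : Coherent κ G) {Z P : Finset V} (hd : Disjoint Z P)
    (hZ : κ * Fintype.card V ≤ Z.card) :
    (P.card : ℝ) < (hits G Z P).card + κ * Fintype.card V := by
  by_contra! hcon
  have h1 : ((P \ hits G Z P).card : ℝ) = P.card - (hits G Z P).card := by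
    rw [Finset.card_sdiff_of_subset (hits_subset G Z P),
      Nat.cast_sub (Finset.card_le_card (hits_subset G Z P))]
  obtain ⟨a, ha, b, hb, hab⟩ := hG.edge Z (P \ hits G Z P) (hd.mono_right Finset.sdiff_subset) hZ
    (by linarith)
  rw [Finset.mem_sdiff] at hb
  exact hb.2 (mem_hits.2 ⟨hb.1, a, ha, hab⟩)

/-- Growing a set vertex by vertex until it hits a quarter of one of the sets `P i`, while the
others are hit in little more than a quarter. -/
theorem Coherent.exists_first_hit {ι : Type*} (hG : Coherent κ G) (I : Finset ι)
    (P : ι → Finset V) (Good : Finset V → Prop)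
    (ext : ∀ D, Good D → (∀ j ∈ I, 4 * ((hits G D (P j)).card : ℝ) < (P j).card) →
      ∃ x ∉ D, Good (insert x D)) (D₀ : Finset V) (h₀ : Good D₀)
    (hs : ∀ j ∈ I, 4 * ((hits G D₀ (P j)).card : ℝ) < (P j).card) :
    ∃ D, Good D ∧ (∃ i ∈ I, ((P i).card : ℝ) ≤ 4 * (hits G D (P i)).card) ∧
      ∀ j ∈ I, 4 * ((hits G D (P j)).card : ℝ) ≤ (P j).card + 4 * (κ * Fintype.card V) := by
  -- The growth stops because `D₀` gains a new vertex each time. Just before the last vertex all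
  -- quarters are still unmet, and that vertex adds at most `κ * Fintype.card V` hits to each
  -- target.
  induction hn : Fintype.card V - D₀.card using Nat.strong_induction_on generalizing D₀ with
  | _ n ih =>
    obtain ⟨x, hx, hgx⟩ := ext D₀ h₀ hs
    by_cases hcase : ∀ j ∈ I, 4 * ((hits G (insert x D₀) (P j)).card : ℝ) < (P j).card
    · refine ih _ ?_ (insert x D₀) hgx hcase rfl
      have h1 := Finset.card_le_univ (insert x D₀)
      rw [Finset.card_insert_of_notMem hx] at h1 ⊢
      omega
    · push Not at hcase
      refine ⟨insert x D₀, hgx, hcase, fun j hj => ?_⟩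
      linarith [hG.card_hits_insert x D₀ (P j), hs j hj]

/-- A set that is not small contains a subset that hits a quarter of one of the `P i`, and not
much more of the others. -/
theorem Coherent.exists_subset_hit {ι : Type*} (hG : Coherent κ G) {I : Finset ι}
    (hI : I.Nonempty) (P : ι → Finset V) (Z : Finset V) (hZ : κ * Fintype.card V ≤ Z.card)
    (hd : ∀ j ∈ I, Disjoint Z (P j)) (hκ : 0 < κ * Fintype.card V)
    (hP : ∀ j ∈ I, 4 * (κ * Fintype.card V) ≤ (P j).card) :
    ∃ X ⊆ Z, (∃ i ∈ I, ((P i).card : ℝ) ≤ 4 * (hits G X (P i)).card) ∧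
      ∀ j ∈ I, 4 * ((hits G X (P j)).card : ℝ) ≤ (P j).card + 4 * (κ * Fintype.card V) := by
  refine hG.exists_first_hit I P (fun D => D ⊆ Z) ?_ ∅ (Finset.empty_subset _) ?_
  · intro D hD hsm
    have hne : ∃ x ∈ Z, x ∉ D := by
      by_contra! hcon
      obtain rfl : D = Z := hD.antisymm hcon
      obtain ⟨i, hi⟩ := hI
      have h1 := hG.card_lt_hits_add (hd i hi) hZ
      linarith [hsm i hi, hP i hi]
    obtain ⟨x, hxZ, hxD⟩ := hne
    exact ⟨x, hxD, Finset.insert_subset hxZ hD⟩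
  · intro j hj
    have : hits G ∅ (P j) = ∅ := by simp [hits]
    rw [this]
    simp only [Finset.card_empty, Nat.cast_zero, mul_zero]
    linarith [hP j hj]

/-- A set that is not small contains a connected set that makes up nearly all of it and has no
edges to the rest. -/
theorem Coherent.exists_giant (hG : Coherent κ G) {R : Finset V} (hκ : 0 < κ * Fintype.card V)
    (hR : 3 * (κ * Fintype.card V) ≤ R.card) :
    ∃ S ⊆ R, CutConnected G S ∧ (R.card : ℝ) ≤ S.card + κ * Fintype.card V ∧
      ∀ a ∈ S, ∀ b ∈ R \ S, ¬ G.Adj a b := by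
  classical
  set c := κ * Fintype.card V with hc
  -- A smallest closed set of size at least `c` is connected: an uncrossed cut would have two closed
  -- sides, both smaller than `c` by minimality, whereas coherence forces the set to have size at
  -- least `R.card - c ≥ 2 * c`.
  set F : Finset (Finset V) := R.powerset.filter fun S => (∀ a ∈ S, ∀ b ∈ R \ S, ¬ G.Adj a b) ∧
    c ≤ S.card with hF
  obtain ⟨S, hS, hmin⟩ := F.exists_min_image Finset.card
    ⟨R, by simp only [hF, Finset.mem_filter, Finset.mem_powerset, subset_rfl, true_and]
           exact ⟨by simp, by linarith⟩⟩
  simp only [hF, Finset.mem_filter, Finset.mem_powerset] at hS hmin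
  obtain ⟨hSR, hSc, hScard⟩ := hS
  have hco : (R.card : ℝ) ≤ S.card + c := by
    by_contra! hcon
    obtain ⟨a, ha, b, hb, hab⟩ := hG.edge S (R \ S) Finset.disjoint_sdiff hScard (by
      rw [Finset.card_sdiff_of_subset hSR, Nat.cast_sub (Finset.card_le_card hSR)]; linarith)
    exact hSc a ha b hb hab
  refine ⟨S, hSR, fun A hA hne hne' => ?_, hco, hSc⟩
  by_contra! hcon
  have small : ∀ B ⊆ S, (S \ B).Nonempty → (∀ a ∈ B, ∀ b ∈ S \ B, ¬ G.Adj a b) → (B.card : ℝ) < c := by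
    intro B hB hne hBc
    by_contra! hcB
    have h1 := hmin B ⟨hB.trans hSR, fun a ha b hb => by
      rw [Finset.mem_sdiff] at hb
      by_cases hbS : b ∈ S
      · exact hBc a ha b (Finset.mem_sdiff.2 ⟨hbS, hb.2⟩)
      · exact hSc a (hB ha) b (Finset.mem_sdiff.2 ⟨hb.1, hbS⟩), hcB⟩
    have h2 : B = S := Finset.eq_of_subset_of_card_le hB h1
    rw [h2, Finset.sdiff_self] at hne
    exact Finset.not_nonempty_empty hne
  have h1 := small A hA hne' hcon
  have h2 := small (S \ A) Finset.sdiff_subset (by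
    rw [Finset.sdiff_sdiff_eq_self hA]; exact hne) (fun a ha b hb => by
    rw [Finset.sdiff_sdiff_eq_self hA] at hb
    intro hab
    exact hcon b hb a ha hab.symm)
  rw [Finset.card_sdiff_of_subset hA, Nat.cast_sub (Finset.card_le_card hA)] at h2
  linarith

/-- One step of growing an induced path into a connected set. -/
theorem Coherent.exists_step (hG : Coherent κ G) {S : Finset V} (hS : CutConnected G S) (v : V)
    (hv : v ∈ S ∨ ∃ y ∈ S, G.Adj v y) (hκ : 1 ≤ κ * Fintype.card V)
    (hc : 5 * (κ * Fintype.card V) ≤ S.card) :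
    ∃ S' ⊆ S, CutConnected G S' ∧ (S.card : ℝ) ≤ S'.card + 3 * (κ * Fintype.card V) ∧
      v ∉ S' ∧ (∀ s ∈ S', ¬ G.Adj v s) ∧ ∃ x ∈ S, x ∉ S' ∧ G.Adj v x ∧ ∃ y ∈ S', G.Adj x y := by
  classical
  set c := κ * Fintype.card V with hcdef
  set S₁ : Finset V := S \ insert v (nbrsIn G v Finset.univ) with hS₁
  have hS₁c : (S.card : ℝ) ≤ S₁.card + 2 * c := by
    have h1 : S.card ≤ S₁.card + (insert v (nbrsIn G v Finset.univ)).card := by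
      have := Finset.le_card_sdiff (insert v (nbrsIn G v Finset.univ)) S
      rw [← hS₁] at this
      omega
    have h2 := Finset.card_insert_le v (nbrsIn G v Finset.univ)
    have h3 : (S.card : ℝ) ≤ S₁.card + ((nbrsIn G v Finset.univ).card + 1) := by
      exact_mod_cast h1.trans (by omega)
    linarith [hG.deg v]
  obtain ⟨S', hS', hconn, hcard, hclosed⟩ := hG.exists_giant (R := S₁) (by linarith) (by linarith)
  have hS'S : S' ⊆ S := hS'.trans Finset.sdiff_subset
  have hS'v : ∀ s ∈ S', s ≠ v ∧ ¬ G.Adj v s := by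
    intro s hs
    have := hS' hs
    simp only [hS₁, Finset.mem_sdiff, Finset.mem_insert, mem_nbrsIn, Finset.mem_univ, true_and,
      not_or] at this
    exact this.2
  have hne : S'.Nonempty := by
    rw [← Finset.card_pos]
    have : (0 : ℝ) < S'.card := by linarith
    exact_mod_cast this
  have hne' : (S \ S').Nonempty := by
    rcases hv with hv | ⟨y, hy, hvy⟩
    · exact ⟨v, Finset.mem_sdiff.2 ⟨hv, fun h => (hS'v v h).1 rfl⟩⟩
    · exact ⟨y, Finset.mem_sdiff.2 ⟨hy, fun h => (hS'v y h).2 hvy⟩⟩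
  -- An edge of `S` that leaves `S'` cannot end in `S₁`, where `S'` is closed, nor in `v`; so it
  -- ends in a neighbour of `v`.
  obtain ⟨y, hy, x, hx, hxy⟩ := hS S' hS'S hne hne'
  rw [Finset.mem_sdiff] at hx
  refine ⟨S', hS'S, hconn, by linarith, fun h => (hS'v v h).1 rfl, fun s hs => (hS'v s hs).2, x, hx.1,
    hx.2, ?_, y, hy, hxy.symm⟩
  by_contra hvx
  by_cases hxv : x = v
  · subst hxv
    exact (hS'v y hy).2 hxy.symm
  · refine hclosed y hy x (Finset.mem_sdiff.2 ⟨?_, hx.2⟩) hxy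
    simp only [hS₁, Finset.mem_sdiff, Finset.mem_insert, mem_nbrsIn, Finset.mem_univ, true_and]
    exact ⟨hx.1, not_or.2 ⟨hxv, hvx⟩⟩

/-- A long induced path in `R` whose last vertex, and no other one, has neighbours in a large
connected subset of `R`. -/
theorem Coherent.exists_inducedPath (hG : Coherent κ G) {R : Finset V}
    (hκ : 1 ≤ κ * Fintype.card V) (k : ℕ) (hR : (4 * k + 10) * (κ * Fintype.card V) ≤ R.card) :
    ∃ (π : ℕ → V) (S : Finset V), S ⊆ R ∧ CutConnected G S ∧
      (R.card : ℝ) ≤ S.card + (4 * k + 4) * (κ * Fintype.card V) ∧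
      (∀ i ≤ k, π i ∈ R ∧ π i ∉ S) ∧ IsInducedPath G π k ∧
      (∀ i < k, ∀ s ∈ S, ¬ G.Adj (π i) s) ∧ ∃ y ∈ S, G.Adj (π k) y := by
  set c := κ * Fintype.card V with hc
  induction k with
  | zero =>
    simp only [CharP.cast_eq_zero, mul_zero, zero_add] at hR ⊢
    obtain ⟨S₀, hS₀, hconn, hcard, -⟩ := hG.exists_giant (R := R) (by linarith) (by linarith)
    have hne : S₀.Nonempty := by
      rw [← Finset.card_pos]
      have : (0 : ℝ) < S₀.card := by linarith
      exact_mod_cast this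
    obtain ⟨v, hv⟩ := hne
    obtain ⟨S, hS, hSc, hScard, -, -, x, hxS₀, hxS, -, y, hy, hxy⟩ :=
      hG.exists_step hconn v (Or.inl hv) hκ (by linarith)
    refine ⟨fun _ => x, S, hS.trans hS₀, hSc, by linarith, fun i _ => ⟨hS₀ hxS₀, hxS⟩, ?_,
      fun i hi => absurd hi (Nat.not_lt_zero i), y, hy, hxy⟩
    intro i hi j hj
    obtain rfl : i = 0 := by omega
    obtain rfl : j = 0 := by omega
    simp
  | succ k ih =>
    push_cast at hR ⊢
    obtain ⟨π, S, hSR, hSc, hScard, hπ, hpath, hanti, y, hy, hky⟩ := ih (by linarith)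
    -- A step of the Gyárfás path argument: `x` becomes the new end, and the connected set retreats
    -- from the neighbourhood of the old one.
    obtain ⟨S', hS', hS'c, hS'card, hkS', hkanti, x, hxS, hxS', hkx, z, hz, hxz⟩ :=
      hG.exists_step hSc (π k) (Or.inr ⟨y, hy, hky⟩) hκ (by linarith)
    have hx : ∀ i ≤ k, π i ≠ x := fun i hi h => (hπ i hi).2 (h ▸ hxS)
    have hxa : ∀ i ≤ k, (G.Adj (π i) x ↔ i = k) := by
      intro i hi
      rcases hi.lt_or_eq with hlt | rfl
      · exact ⟨fun h => absurd h (hanti i hlt x hxS), fun h => absurd h hlt.ne⟩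
      · exact ⟨fun _ => rfl, fun _ => hkx⟩
    refine ⟨fun i => if i ≤ k then π i else x, S', hS'.trans hSR, hS'c, by linarith, ?_, ?_, ?_, z, hz,
      by simpa using hxz⟩
    · intro i hi
      by_cases h : i ≤ k
      · simp only [h, if_true]
        exact ⟨(hπ i h).1, fun h' => (hπ i h).2 (hS' h')⟩
      · simp only [h, if_false]
        exact ⟨hSR hxS, hxS'⟩
    · intro i hi j hj
      by_cases h : i ≤ k <;> by_cases h' : j ≤ k <;> simp only [h, h', if_true, if_false]
      · exact hpath i h j h'
      · obtain rfl : j = k + 1 := by omega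
        refine ⟨fun e => absurd e (hx i h), ?_⟩
        rw [hxa i h]
        omega
      · obtain rfl : i = k + 1 := by omega
        refine ⟨fun e => absurd e.symm (hx j h'), ?_⟩
        rw [G.adj_comm, hxa j h']
        omega
      · obtain rfl : i = k + 1 := by omega
        obtain rfl : j = k + 1 := by omega
        simp
    · intro i hi s hs
      have h : i ≤ k := by omega
      simp only [h, if_true]
      rcases h.lt_or_eq with hlt | rfl
      · exact hanti i hlt s (hS' hs)
      · exact hkanti s hs

/-- A set that is not small contains a subset `D`, hitting a good part of one of the sets `P i`
and not more than half of the others, such that the vertices of that part start long induced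
paths through `D`. -/
theorem Coherent.exists_subset_hit_path {ι : Type*} (hG : Coherent κ G) {I : Finset ι}
    (hI : I.Nonempty) (P : ι → Finset V) (R : Finset V) (k : ℕ) (hκ : 1 ≤ κ * Fintype.card V)
    (hR : (4 * k + 10) * (κ * Fintype.card V) ≤ R.card) (hd : ∀ j ∈ I, Disjoint R (P j))
    (hP : ∀ j ∈ I, 8 * (k + 3) * (κ * Fintype.card V) ≤ (P j).card) :
    ∃ D ⊆ R, (∃ i ∈ I, ∃ P' ⊆ P i, ((P i).card : ℝ) ≤ 8 * P'.card ∧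
      ∀ p ∈ P', ∃ q : ℕ → V, q 0 = p ∧ (∀ j, 1 ≤ j → j ≤ k → q j ∈ D) ∧ IsInducedPath G q k) ∧
      ∀ j ∈ I, 2 * ((hits G D (P j)).card : ℝ) ≤ (P j).card := by
  set c := κ * Fintype.card V with hc
  obtain ⟨π, S, hSR, hSc, hScard, hπ, hpath, hanti, y, hy, hky⟩ := hG.exists_inducedPath hκ k hR
  set Pth : Finset V := (Finset.range (k + 1)).image π with hPth
  have hPthc : (Pth.card : ℝ) ≤ k + 1 := by
    have : Pth.card ≤ k + 1 := Finset.card_image_le.trans (by simp)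
    exact_mod_cast this
  have hk : (0 : ℝ) ≤ k := Nat.cast_nonneg k
  have hhPth : ∀ Q, ((hits G Pth Q).card : ℝ) ≤ (k + 1) * c := fun Q =>
    (hG.card_hits_le Pth Q).trans (by gcongr)
  have hmemPth : ∀ x, x ∈ Pth ↔ ∃ i ≤ k, π i = x := by
    intro x
    simp only [hPth, Finset.mem_image, Finset.mem_range, Nat.lt_succ_iff]
  have hPthS : ∀ x ∈ S, x ∉ Pth := by
    intro x hx h
    obtain ⟨i, hi, rfl⟩ := (hmemPth x).1 h
    exact (hπ i hi).2 hx
  -- The set that grows is a connected `D'` around `y`, with the whole path `Pth` attached from the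
  -- beginning.
  obtain ⟨D, ⟨D', hyD', hD'S, hD'c, rfl⟩, ⟨i, hi, hhit⟩, hall⟩ := hG.exists_first_hit I P
    (fun D => ∃ D' : Finset V, y ∈ D' ∧ D' ⊆ S ∧ CutConnected G D' ∧ D = D' ∪ Pth) (by
      rintro D ⟨D', hyD', hD'S, hD'c, rfl⟩ hsm
      have hne : (S \ D').Nonempty := by
        rw [Finset.sdiff_nonempty]
        intro hcon
        obtain rfl : D' = S := hD'S.antisymm hcon
        obtain ⟨i, hi⟩ := hI
        have h1 := hG.card_lt_hits_add ((hd i hi).mono_left hSR) (by linarith)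
        have h2 : ((hits G D' (P i)).card : ℝ) ≤ (hits G (D' ∪ Pth) (P i)).card := by
          exact_mod_cast Finset.card_le_card (hits_mono Finset.subset_union_left _)
        have h3 : 24 * c ≤ (P i).card := le_trans (by gcongr; linarith) (hP i hi)
        linarith [hsm i hi]
      obtain ⟨a, ha, b, hb, hab⟩ := hSc D' hD'S ⟨y, hyD'⟩ hne
      rw [Finset.mem_sdiff] at hb
      refine ⟨b, ?_, insert b D', Finset.mem_insert_of_mem hyD', Finset.insert_subset hb.1 hD'S,
        hD'c.insert ha hab.symm, (Finset.insert_union _ _ _).symm⟩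
      rw [Finset.mem_union, not_or]
      exact ⟨hb.2, hPthS b hb.1⟩) ({y} ∪ Pth)
    ⟨{y}, Finset.mem_singleton_self y, Finset.singleton_subset_iff.2 hy, by
      intro A hA hne hne'
      exfalso
      rcases Finset.subset_singleton_iff.1 hA with rfl | rfl
      · exact Finset.not_nonempty_empty hne
      · simp at hne', rfl⟩ (by
      intro j hj
      have h1 : (({y} ∪ Pth : Finset V).card : ℝ) ≤ k + 2 := by
        have h := Finset.card_union_le {y} Pth
        rw [Finset.card_singleton] at h
        have h' : (({y} ∪ Pth : Finset V).card : ℝ) ≤ 1 + Pth.card := by exact_mod_cast h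
        linarith
      have h2 : ((hits G ({y} ∪ Pth) (P j)).card : ℝ) ≤ (k + 2) * c :=
        (hG.card_hits_le _ _).trans (by gcongr)
      have h3 := hP j hj
      nlinarith)
  -- Vertices hit by the path itself are dropped, so that the others can reach it only through `D'`.
  -- The path hits at most `(k + 1) * c` vertices, so a quarter still leaves an eighth.
  refine ⟨D' ∪ Pth, Finset.union_subset (hD'S.trans hSR) ?_, ⟨i, hi, hits G (D' ∪ Pth) (P i) \ hits G Pth (P i),
    Finset.sdiff_subset.trans (hits_subset _ _ _), ?_, ?_⟩, ?_⟩
  · intro x hx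
    obtain ⟨i, hi, rfl⟩ := (hmemPth x).1 hx
    exact (hπ i hi).1
  · have h1 := Finset.le_card_sdiff (hits G Pth (P i)) (hits G (D' ∪ Pth) (P i))
    have h2 : ((hits G (D' ∪ Pth) (P i)).card : ℝ) ≤
        (hits G (D' ∪ Pth) (P i) \ hits G Pth (P i)).card + (hits G Pth (P i)).card := by
      exact_mod_cast (show _ ≤ _ by omega)
    have h3 := hP i hi
    have h4 := hhPth (P i)
    nlinarith
  · intro p hp
    rw [Finset.mem_sdiff] at hp
    obtain ⟨hpP, d, hd', hdp⟩ := mem_hits.1 hp.1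
    have hpPth : ∀ x ∈ Pth, ¬ G.Adj x p := fun x hx h => hp.2 (mem_hits.2 ⟨hpP, x, hx, h⟩)
    have hdD' : d ∈ D' := by
      rcases Finset.mem_union.1 hd' with h | h
      · exact h
      · exact absurd hdp (hpPth d h)
    have hpR : p ∉ R := fun h => Finset.disjoint_left.1 (hd i hi) h hpP
    have hconn : ∀ m ≤ k + 1, CutConnected G (D' ∪ (Finset.range m).image fun i => π (k - i)) := by
      intro m hm
      induction m with
      | zero => simpa using hD'c
      | succ m ih =>
        rw [Finset.range_add_one, Finset.image_insert, Finset.union_insert]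
        rcases Nat.eq_zero_or_pos m with rfl | hm0
        · exact (ih (by omega)).insert (y := y) (Finset.mem_union_left _ hyD') (by simpa using hky)
        · refine (ih (by omega)).insert (y := π (k - (m - 1)))
            (Finset.mem_union_right _ (Finset.mem_image.2 ⟨m - 1, by simp; omega, rfl⟩)) ?_
          exact (hpath (k - m) (by omega) (k - (m - 1)) (by omega)).2.2 (by omega)
    have hPth' : (Finset.range (k + 1)).image (fun i => π (k - i)) = Pth := by
      ext x
      simp only [hPth, Finset.mem_image, Finset.mem_range]
      constructor
      · rintro ⟨j, _, rfl⟩; exact ⟨k - j, by omega, rfl⟩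
      · rintro ⟨j, hj, rfl⟩
        refine ⟨k - j, by omega, ?_⟩
        congr 1
        omega
    have hconn' : CutConnected G (insert p (D' ∪ Pth)) := by
      have := hconn (k + 1) le_rfl
      rw [hPth'] at this
      exact this.insert hd' hdp.symm
    classical
    -- `w` is `k - j` at `π j` and `0` off the path. It is Lipschitz because `D'` meets the path
    -- only at `π k`, where `w` vanishes, and `p` has no neighbour on it. So `p` is at distance at
    -- least `k` from `π 0`.
    set w : V → ℕ := fun x => if h : ∃ i ≤ k, π i = x then k - h.choose else 0 with hw
    have hwπ : ∀ j ≤ k, w (π j) = k - j := by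
      intro j hj
      have h : ∃ i ≤ k, π i = π j := ⟨j, hj, rfl⟩
      simp only [hw, h, dif_pos]
      rw [(hpath _ h.choose_spec.1 j hj).1 h.choose_spec.2]
    have hw0 : ∀ x, x ∉ Pth → w x = 0 := by
      intro x hx
      rw [hmemPth] at hx
      simp only [hw, hx, dif_neg, not_false_iff]
    have hcross : ∀ j ≤ k, ∀ x ∈ insert p (D' ∪ Pth), x ∉ Pth → G.Adj (π j) x → w (π j) = 0 := by
      intro j hj x hx hxPth hadj
      rcases Finset.mem_insert.1 hx with rfl | hx
      · exact absurd hadj (hpPth _ ((hmemPth _).2 ⟨j, hj, rfl⟩))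
      · have hxD' := (Finset.mem_union.1 hx).resolve_right hxPth
        rcases hj.lt_or_eq with h | rfl
        · exact absurd hadj (hanti j h x (hD'S hxD'))
        · rw [hwπ j le_rfl]; omega
    obtain ⟨q, hq0, hq, hqp⟩ := hconn'.exists_inducedPath (p := p) (r := π 0) (k := k)
      (Finset.mem_insert_self _ _)
      (Finset.mem_insert_of_mem (Finset.mem_union_right _ ((hmemPth _).2 ⟨0, Nat.zero_le _, rfl⟩))) w (by
        intro a ha b hb hab
        by_cases haPth : a ∈ Pth <;> by_cases hbPth : b ∈ Pth
        · obtain ⟨i, hi, rfl⟩ := (hmemPth a).1 haPth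
          obtain ⟨j, hj, rfl⟩ := (hmemPth b).1 hbPth
          rw [hwπ i hi, hwπ j hj]
          have := (hpath i hi j hj).2.1 hab
          omega
        · rw [hw0 b hbPth]; omega
        · obtain ⟨j, hj, rfl⟩ := (hmemPth b).1 hbPth
          rw [hcross j hj a ha haPth hab.symm]; omega
        · rw [hw0 b hbPth]; omega)
      (hw0 p fun h => by
        obtain ⟨j, hj, rfl⟩ := (hmemPth p).1 h
        exact hpR (hπ j hj).1) (by rw [hwπ 0 (Nat.zero_le _)]; rfl)
    refine ⟨q, hq0, fun j hj hjk => ?_, hqp⟩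
    refine (Finset.mem_insert.1 (hq j)).resolve_left fun h => ?_
    have := (hqp j hjk 0 (Nat.zero_le _)).1 (by rw [hq0, h])
    omega
  · intro j hj
    have h1 := hall j hj
    have h2 : 24 * c ≤ (P j).card := le_trans (by gcongr; linarith) (hP j hj)
    linarith

end Growth

/-! ### Partial caterpillars and the two ways to enlarge them. -/

section Game

/-- Adjacency in the universal caterpillar: `(i, 0, 0)` are the spine vertices, and `(i, j, k)` with
`1 ≤ k` is the `k`-th vertex of the `j`-th leg at `(i, 0, 0)`. -/
def LegAdj (a b : ℕ × ℕ × ℕ) : Prop :=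
  (a.2.2 = 0 ∧ b.2.2 = 0 ∧ (a.1 + 1 = b.1 ∨ b.1 + 1 = a.1)) ∨
    (a.1 = b.1 ∧ (a.2.1 = b.2.1 ∨ a.2.2 = 0 ∨ b.2.2 = 0) ∧
      (a.2.2 + 1 = b.2.2 ∨ b.2.2 + 1 = a.2.2))

theorem LegAdj.symm {a b : ℕ × ℕ × ℕ} (h : LegAdj a b) : LegAdj b a := by
  unfold LegAdj at h ⊢
  omega

/-- The caterpillar with spine vertices `0, …, t`, with `d` legs of length `l` at each of the first
`t` spine vertices, and `h` legs at the last one. -/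
def IsCatVertex (d l t h : ℕ) (a : ℕ × ℕ × ℕ) : Prop :=
  (a.2.1 = 0 ∧ a.2.2 = 0 ∧ a.1 ≤ t) ∨
    (1 ≤ a.2.2 ∧ a.2.2 ≤ l ∧ ((a.1 < t ∧ a.2.1 < d) ∨ (a.1 = t ∧ a.2.1 < h)))

variable {V : Type u}

/-- `D` and `z` contain an induced copy of a caterpillar in which `z` is the last spine vertex. -/
def HasCat (G : SimpleGraph V) (d l t h : ℕ) (D : Finset V) (z : V) : Prop :=
  ∃ f : ℕ × ℕ × ℕ → V, f (t, 0, 0) = z ∧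
    (∀ a, IsCatVertex d l t h a → a ≠ (t, 0, 0) → f a ∈ D) ∧
    ∀ a b, IsCatVertex d l t h a → IsCatVertex d l t h b →
      (f a = f b → a = b) ∧ (G.Adj (f a) (f b) ↔ LegAdj a b)

/-- `A` and `B` are disjoint and without edges between them. -/
def Separated (G : SimpleGraph V) (A B : Finset V) : Prop :=
  ∀ a ∈ A, ∀ b ∈ B, a ≠ b ∧ ¬ G.Adj a b

theorem Separated.symm {G : SimpleGraph V} {A B : Finset V} (h : Separated G A B) :
    Separated G B A := fun b hb a ha => ⟨(h a ha b hb).1.symm, fun e => (h a ha b hb).2 e.symm⟩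

theorem Separated.mono {G : SimpleGraph V} {A B A' B' : Finset V} (h : Separated G A B)
    (hA : A' ⊆ A) (hB : B' ⊆ B) : Separated G A' B' :=
  fun a ha b hb => h a (hA ha) b (hB hb)

theorem Separated.union_left [DecidableEq V] {G : SimpleGraph V} {A A' B : Finset V}
    (h : Separated G A B) (h' : Separated G A' B) : Separated G (A ∪ A') B :=
  fun a ha b hb => (Finset.mem_union.1 ha).elim (fun ha => h a ha b hb) fun ha => h' a ha b hb

theorem hasCat_bare (G : SimpleGraph V) (d l : ℕ) (D : Finset V) (z : V) : HasCat G d l 0 0 D z := by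
  have key : ∀ a, IsCatVertex d l 0 0 a → a = (0, 0, 0) := by
    rintro ⟨i, j, k⟩ h
    simp only [IsCatVertex] at h
    simp only [Prod.mk.injEq]
    omega
  refine ⟨fun _ => z, rfl, fun a ha hne => absurd (key a ha) hne, fun a b ha hb => ?_⟩
  obtain rfl := key a ha
  obtain rfl := key b hb
  simp [LegAdj]

variable [DecidableEq V] {G : SimpleGraph V}

/-- Legs are numbered from `0`, so the new one has number `h`. It meets the old copy only at `z`,
since `E` is separated from `D`. -/
theorem HasCat.add_leg {d l t h : ℕ} {D E : Finset V} {z : V} (hc : HasCat G d l t h D z)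
    (hh : h < d) {q : ℕ → V} (hq0 : q 0 = z) (hqE : ∀ j, 1 ≤ j → j ≤ l → q j ∈ E)
    (hq : IsInducedPath G q l) (hDE : Separated G D E) : HasCat G d l t (h + 1) (D ∪ E) z := by
  obtain ⟨f, hft, hfD, hf⟩ := hc
  have split : ∀ a, IsCatVertex d l t (h + 1) a → (¬ (a.1 = t ∧ a.2.1 = h ∧ 1 ≤ a.2.2) ∧
      IsCatVertex d l t h a) ∨ ((a.1 = t ∧ a.2.1 = h ∧ 1 ≤ a.2.2) ∧ a.2.2 ≤ l) := by
    rintro ⟨i, j, k⟩ ha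
    simp only [IsCatVertex] at ha ⊢
    omega
  have cross : ∀ a b, IsCatVertex d l t h a → ¬ (a.1 = t ∧ a.2.1 = h ∧ 1 ≤ a.2.2) →
      (b.1 = t ∧ b.2.1 = h ∧ 1 ≤ b.2.2) → b.2.2 ≤ l →
      f a ≠ q b.2.2 ∧ (G.Adj (f a) (q b.2.2) ↔ LegAdj a b) := by
    rintro ⟨i, j, k⟩ ⟨i', j', k'⟩ ha ha' hb hbl
    simp only at hb hbl ha'
    obtain ⟨rfl, rfl, hk'⟩ := hb
    by_cases hroot : ((i, j, k) : ℕ × ℕ × ℕ) = (i', 0, 0)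
    · obtain ⟨rfl, rfl, rfl⟩ : i = i' ∧ j = 0 ∧ k = 0 := by simpa using hroot
      rw [hft, ← hq0]
      have := hq 0 (Nat.zero_le _) k' hbl
      refine ⟨fun e => ?_, this.2.trans ?_⟩
      · have := this.1 e
        omega
      · simp only [LegAdj, true_and, true_or, or_true]
        omega
    · have h1 := hDE _ (hfD _ ha hroot) _ (hqE k' hk' hbl)
      refine ⟨h1.1, fun e => absurd e h1.2, fun e => ?_⟩
      exfalso
      simp only [LegAdj, IsCatVertex, Prod.mk.injEq] at *
      omega
  refine ⟨fun a => if a.1 = t ∧ a.2.1 = h ∧ 1 ≤ a.2.2 then q a.2.2 else f a, by simp [hft], ?_, ?_⟩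
  · intro a ha hne
    rcases split a ha with ⟨h1, h2⟩ | ⟨h1, h2⟩
    · simp only [h1, if_false]
      exact Finset.mem_union_left _ (hfD a h2 hne)
    · simp only [h1, and_self, if_true]
      exact Finset.mem_union_right _ (hqE _ h1.2.2 h2)
  · intro a b ha hb
    rcases split a ha with ⟨h1, h2⟩ | ⟨h1, h2⟩ <;> rcases split b hb with ⟨h3, h4⟩ | ⟨h3, h4⟩ <;> beta_reduce
    · rw [if_neg h1, if_neg h3]
      exact hf a b h2 h4
    · rw [if_neg h1, if_pos h3]
      have := cross a b h2 h1 h3 h4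
      exact ⟨fun e => absurd e this.1, this.2⟩
    · rw [if_pos h1, if_neg h3]
      have := cross b a h4 h3 h1 h2
      exact ⟨fun e => absurd e.symm this.1, (G.adj_comm _ _).trans
        (this.2.trans ⟨LegAdj.symm, LegAdj.symm⟩)⟩
    · rw [if_pos h1, if_pos h3]
      have := hq _ h2 _ h4
      refine ⟨fun e => ?_, this.2.trans ?_⟩
      · have := this.1 e
        obtain ⟨i, j, k⟩ := a
        obtain ⟨i', j', k'⟩ := b
        simp only [Prod.mk.injEq] at *
        omega
      · obtain ⟨i, j, k⟩ := a
        obtain ⟨i', j', k'⟩ := b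
        simp only [LegAdj] at *
        omega

/-- The spine of `x` is continued by `z`. Of the copy at `z` only `z` and its own `h` legs are kept;
its earlier spine is discarded. -/
theorem HasCat.add_spine {d l t s h : ℕ} {D D' : Finset V} {x z : V} (hx : HasCat G d l t d D x)
    (hz : HasCat G d l s h D' z) (hst : s ≤ t) (hxz : G.Adj x z)
    (hDD : Separated G (insert x D) D') (hDz : Separated G D {z}) :
    HasCat G d l (t + 1) h (D' ∪ insert x D) z := by
  obtain ⟨f, hft, hfD, hf⟩ := hx
  obtain ⟨g, hgt, hgD, hg⟩ := hz
  have split : ∀ a, IsCatVertex d l (t + 1) h a → (a.1 ≤ t ∧ IsCatVertex d l t d a) ∨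
      (¬ a.1 ≤ t ∧ a.1 = t + 1 ∧ IsCatVertex d l s h (s, a.2)) := by
    rintro ⟨i, j, k⟩ ha
    simp only [IsCatVertex, true_and] at ha ⊢
    omega
  have hfD' : ∀ a, IsCatVertex d l t d a → f a ∈ insert x D := by
    intro a ha
    by_cases h : a = (t, 0, 0)
    · rw [h, hft]; exact Finset.mem_insert_self _ _
    · exact Finset.mem_insert_of_mem (hfD a ha h)
  have cross : ∀ a b, IsCatVertex d l t d a → b.1 = t + 1 → IsCatVertex d l s h (s, b.2) →
      f a ≠ g (s, b.2) ∧ (G.Adj (f a) (g (s, b.2)) ↔ LegAdj a b) := by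
    rintro ⟨i, j, k⟩ ⟨i', j', k'⟩ ha hb' hb
    simp only at hb hb'
    subst hb'
    by_cases hb0 : (s, j', k') = (s, 0, 0)
    · obtain ⟨rfl, rfl⟩ : j' = 0 ∧ k' = 0 := by simpa using hb0
      simp only
      rw [hgt]
      by_cases hroot : ((i, j, k) : ℕ × ℕ × ℕ) = (t, 0, 0)
      · obtain ⟨rfl, rfl, rfl⟩ : i = t ∧ j = 0 ∧ k = 0 := by simpa using hroot
        rw [hft]
        exact ⟨hxz.ne, fun _ => by simp [LegAdj], fun _ => hxz⟩
      · have h1 := hDz _ (hfD _ ha hroot) z (Finset.mem_singleton_self z)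
        refine ⟨h1.1, fun e => absurd e h1.2, fun e => ?_⟩
        exfalso
        simp only [LegAdj, IsCatVertex, Prod.mk.injEq, true_and] at *
        omega
    · have h1 := hDD _ (hfD' _ ha) _ (hgD _ hb hb0)
      refine ⟨h1.1, fun e => absurd e h1.2, fun e => ?_⟩
      exfalso
      simp only [LegAdj, IsCatVertex, Prod.mk.injEq, true_and] at *
      omega
  refine ⟨fun a => if a.1 ≤ t then f a else g (s, a.2), by simp [hgt], ?_, ?_⟩
  · intro a ha hne
    rcases split a ha with ⟨h1, h2⟩ | ⟨h1, h2, h3⟩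
    · simp only [h1, if_true]
      exact Finset.mem_union_right _ (hfD' a h2)
    · simp only [h1, if_false]
      refine Finset.mem_union_left _ (hgD _ h3 fun e => hne ?_)
      obtain ⟨i, j, k⟩ := a
      simp only [Prod.mk.injEq] at *
      omega
  · intro a b ha hb
    rcases split a ha with ⟨h1, h2⟩ | ⟨h1, h1', h2⟩ <;>
      rcases split b hb with ⟨h3, h4⟩ | ⟨h3, h3', h4⟩ <;> beta_reduce
    · rw [if_pos h1, if_pos h3]
      exact hf a b h2 h4
    · rw [if_pos h1, if_neg h3]
      have := cross a b h2 h3' h4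
      exact ⟨fun e => absurd e this.1, this.2⟩
    · rw [if_neg h1, if_pos h3]
      have := cross b a h4 h1' h2
      exact ⟨fun e => absurd e.symm this.1, (G.adj_comm _ _).trans
        (this.2.trans ⟨LegAdj.symm, LegAdj.symm⟩)⟩
    · rw [if_neg h1, if_neg h3]
      have := hg _ _ h2 h4
      refine ⟨fun e => ?_, this.2.trans ?_⟩
      · have := this.1 e
        obtain ⟨i, j, k⟩ := a
        obtain ⟨i', j', k'⟩ := b
        simp only [Prod.mk.injEq] at *
        omega
      · obtain ⟨i, j, k⟩ := a
        obtain ⟨i', j', k'⟩ := b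
        simp only [LegAdj, true_and] at *
        omega

end Game

/-! ### The merging game on families of candidate sets. -/

section Tokens

variable {V : Type u} {G : SimpleGraph V}

theorem HasCat.mono {d l t h : ℕ} {D D' : Finset V} {z : V} (hc : HasCat G d l t h D z)
    (hD : D ⊆ D') : HasCat G d l t h D' z :=
  let ⟨f, hft, hfD, hf⟩ := hc
  ⟨f, hft, fun a ha hne => hD (hfD a ha hne), hf⟩

/-- Each vertex of `Z` starts an induced path of length `l` that continues in `E`. -/
def HasPaths (G : SimpleGraph V) (l : ℕ) (Z E : Finset V) : Prop :=
  ∀ z ∈ Z, ∃ q : ℕ → V, q 0 = z ∧ (∀ j, 1 ≤ j → j ≤ l → q j ∈ E) ∧ IsInducedPath G q l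

theorem HasPaths.mono {l : ℕ} {Z E E' : Finset V} (h : HasPaths G l Z E) (hE : E ⊆ E') :
    HasPaths G l Z E' := fun z hz =>
  let ⟨q, h0, hq, hp⟩ := h z hz
  ⟨q, h0, fun j h1 h2 => hE (hq j h1 h2), hp⟩

theorem IsInducedPath.cons {q : ℕ → V} {l : ℕ} (hq : IsInducedPath G q l) {z : V}
    (hz : G.Adj z (q 0)) (hne : ∀ j, 1 ≤ j → j ≤ l → z ≠ q j ∧ ¬ G.Adj z (q j)) :
    IsInducedPath G (fun j => j.casesOn z q) l := by
  have key : ∀ j, j ≤ l → z ≠ q j ∧ (G.Adj z (q j) ↔ j = 0) := by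
    intro j hj
    rcases Nat.eq_zero_or_pos j with rfl | h
    · exact ⟨hz.ne, by simp [hz]⟩
    · exact ⟨(hne j h hj).1, fun e => absurd e (hne j h hj).2, by omega⟩
  rintro (_ | i) hi (_ | j) hj
  · simp
  · have := key j (by omega)
    refine ⟨fun e => absurd e this.1, this.2.trans (by omega)⟩
  · have := key i (by omega)
    refine ⟨fun e => absurd e.symm this.1, (G.adj_comm _ _).trans (this.2.trans (by omega))⟩
  · have := hq i (by omega) j (by omega)
    refine ⟨fun e => ?_, this.2.trans (by omega)⟩
    have := this.1 e
    omega

/-- A family of candidate sets `Z i`, each vertex of which is the last spine vertex of a partial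
caterpillar in `D i` that is described by `t i` and `h i`. -/
structure IsTokenFamily {ι : Type*} (G : SimpleGraph V) (d l : ℕ) (I : Finset ι)
    (Z D : ι → Finset V) (t h : ι → ℕ) : Prop where
  legs_le : ∀ i ∈ I, h i ≤ d
  disjoint : ∀ i ∈ I, ∀ j ∈ I, i ≠ j → Disjoint (Z i) (Z j)
  sep : ∀ i ∈ I, ∀ j ∈ I, i ≠ j → Separated G (D i) (D j)
  sep' : ∀ i ∈ I, ∀ j ∈ I, i ≠ j → Separated G (D i) (Z j)
  cat : ∀ i ∈ I, ∀ z ∈ Z i, HasCat G d l (t i) (h i) (D i) z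
  paths : ∀ i ∈ I, 0 < t i * (d + 1) + h i → HasPaths G l (Z i) (D i)

variable [DecidableEq V]

/-- Since `E` consists of material of the spent token `x`, its separation from the sets `D j` is
inherited. Only the separation from the candidates `Z' j` has to be arranged by shrinking them. -/
theorem IsTokenFamily.merge {ι : Type*} [DecidableEq ι] {d l : ℕ} {I : Finset ι}
    {Z D : ι → Finset V} {t h : ι → ℕ} (H : IsTokenFamily G d l I Z D t h) {x y : ι} (hx : x ∈ I)
    (hy : y ∈ I.erase x) {Z' : ι → Finset V} (hZ' : ∀ j ∈ I.erase x, Z' j ⊆ Z j) {E : Finset V}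
    (hE : E ⊆ Z x ∪ D x) (hEZ : ∀ j ∈ I.erase x, j ≠ y → Separated G E (Z' j)) {s g : ℕ}
    (hg : g ≤ d) (hcat : ∀ z ∈ Z' y, HasCat G d l s g (D y ∪ E) z) (hp : HasPaths G l (Z' y) E) :
    IsTokenFamily G d l (I.erase x) Z' (Function.update D y (D y ∪ E)) (Function.update t y s)
      (Function.update h y g) := by
  have hyI := Finset.mem_of_mem_erase hy
  have hED : ∀ j ∈ I.erase x, Separated G E (D j) := by
    intro j hj e he b hb
    have hjx := Finset.ne_of_mem_erase hj
    have hj := Finset.mem_of_mem_erase hj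
    rcases Finset.mem_union.1 (hE he) with he | he
    · exact (H.sep' j hj x hx hjx).symm e he b hb
    · exact H.sep x hx j hj hjx.symm e he b hb
  refine ⟨?_, ?_, ?_, ?_, ?_, ?_⟩
  · intro i hi
    by_cases hiy : i = y
    · subst hiy; simpa using hg
    · simpa [hiy] using H.legs_le i (Finset.mem_of_mem_erase hi)
  · intro i hi j hj hij
    exact (H.disjoint i (Finset.mem_of_mem_erase hi) j (Finset.mem_of_mem_erase hj) hij).mono
      (hZ' i hi) (hZ' j hj)
  · have key : ∀ j ∈ I.erase x, j ≠ y → Separated G (D y ∪ E) (D j) := fun j hj hjy =>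
      (H.sep y hyI j (Finset.mem_of_mem_erase hj) hjy.symm).union_left (hED j hj)
    intro i hi j hj hij
    by_cases hiy : i = y
    · subst hiy
      simpa [hij.symm] using key j hj hij.symm
    · by_cases hjy : j = y
      · subst hjy
        simpa [hij] using (key i hi hij).symm
      · simpa [hiy, hjy] using
          H.sep i (Finset.mem_of_mem_erase hi) j (Finset.mem_of_mem_erase hj) hij
  · intro i hi j hj hij
    have h1 := (H.sep' i (Finset.mem_of_mem_erase hi) j (Finset.mem_of_mem_erase hj) hij).mono
      subset_rfl (hZ' j hj)
    by_cases hiy : i = y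
    · subst hiy
      simpa using h1.union_left (hEZ j hj hij.symm)
    · simpa [hiy] using h1
  · intro i hi z hz
    by_cases hiy : i = y
    · subst hiy
      simpa using hcat z hz
    · simpa [hiy] using H.cat i (Finset.mem_of_mem_erase hi) z (hZ' i hi hz)
  · intro i hi
    by_cases hiy : i = y
    · subst hiy
      intro _
      simpa using hp.mono Finset.subset_union_right
    · intro hr
      simp only [ne_eq, hiy, not_false_iff, Function.update_of_ne] at hr ⊢
      exact fun z hz => H.paths i (Finset.mem_of_mem_erase hi) hr z (hZ' i hi hz)

/-- The candidates of the token `x` are used to attach a path, and in fact the whole partial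
caterpillar of `x` unless it is a single vertex, to many candidates of some other token `y`. -/
theorem IsTokenFamily.exists_hit [Fintype V] {κ : ℝ} {ι : Type*} [DecidableEq ι] {d l : ℕ}
    {I : Finset ι} {Z D : ι → Finset V} {t h : ι → ℕ} (H : IsTokenFamily G d l I Z D t h)
    (hG : Coherent κ G) (hκ : 1 ≤ κ * Fintype.card V)
    (hZ : ∀ i ∈ I, 8 * (l + 3) * (κ * Fintype.card V) ≤ (Z i).card) {x : ι} (hx : x ∈ I)
    (hI : (I.erase x).Nonempty) :
    ∃ y ∈ I.erase x, ∃ (Z' : ι → Finset V) (E : Finset V), (∀ j ∈ I.erase x, Z' j ⊆ Z j) ∧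
      (∀ j ∈ I.erase x, ((Z j).card : ℝ) ≤ 8 * (Z' j).card) ∧ E ⊆ Z x ∪ D x ∧
      (∀ j ∈ I.erase x, j ≠ y → Separated G E (Z' j)) ∧ HasPaths G l (Z' y) E ∧
      (0 < t x * (d + 1) + h x →
        ∀ z ∈ Z' y, ∃ a ∈ Z x, G.Adj a z ∧ insert a (D x) ⊆ E) := by
  set c := κ * Fintype.card V with hc
  have hl : (0 : ℝ) ≤ l := Nat.cast_nonneg l
  have hdis : ∀ j ∈ I.erase x, Disjoint (Z x) (Z j) := fun j hj =>
    H.disjoint x hx j (Finset.mem_of_mem_erase hj) (Finset.ne_of_mem_erase hj).symm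
  have hbig : ∀ i ∈ I, 24 * c ≤ (Z i).card := fun i hi => le_trans (by gcongr; linarith) (hZ i hi)
  have hcard : ∀ X j, ((Z j).card : ℝ) = (Z j \ hits G X (Z j)).card + (hits G X (Z j)).card := by
    intro X j
    rw [Finset.card_sdiff_of_subset (hits_subset G X (Z j)),
      Nat.cast_sub (Finset.card_le_card (hits_subset G X (Z j)))]
    ring
  have hsep : ∀ X ⊆ Z x, ∀ j ∈ I.erase x, Separated G X (Z j \ hits G X (Z j)) := by
    intro X hX j hj a ha b hb
    rw [Finset.mem_sdiff] at hb
    refine ⟨?_, fun e => hb.2 (mem_hits.2 ⟨hb.1, a, ha, e⟩)⟩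
    rintro rfl
    exact Finset.disjoint_left.1 (hdis j hj) (hX ha) hb.1
  by_cases hr : 0 < t x * (d + 1) + h x
  · obtain ⟨X, hXZ, ⟨y, hy, hyc⟩, hall⟩ := hG.exists_subset_hit hI Z (Z x)
      (by linarith [hbig x hx]) hdis (by linarith)
      (fun j hj => by linarith [hbig j (Finset.mem_of_mem_erase hj)])
    have hhit : ∀ z ∈ hits G X (Z y), ∃ a ∈ Z x, G.Adj a z ∧ insert a (D x) ⊆ X ∪ D x := by
      intro z hz
      obtain ⟨-, a, ha, haz⟩ := mem_hits.1 hz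
      exact ⟨a, hXZ ha, haz, Finset.insert_subset (Finset.mem_union_left _ ha)
        Finset.subset_union_right⟩
    refine ⟨y, hy, fun j => if j = y then hits G X (Z y) else Z j \ hits G X (Z j), X ∪ D x,
      ?_, ?_, Finset.union_subset_union_left hXZ, ?_, ?_, ?_⟩
    · intro j hj
      by_cases hjy : j = y
      · subst hjy; simpa using hits_subset _ _ _
      · simp [hjy]
    · intro j hj
      by_cases hjy : j = y
      · subst hjy
        simp only [if_true]
        have : (0 : ℝ) ≤ (hits G X (Z j)).card := Nat.cast_nonneg _
        linarith
      · simp only [hjy, if_false]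
        have h1 := hall j hj
        have h2 := hcard X j
        have h3 := hbig j (Finset.mem_of_mem_erase hj)
        linarith
    · intro j hj hjy
      simp only [hjy, if_false]
      exact (hsep X hXZ j hj).union_left ((H.sep' x hx j (Finset.mem_of_mem_erase hj)
        (Finset.ne_of_mem_erase hj).symm).mono subset_rfl Finset.sdiff_subset)
    · intro z hz
      simp only [if_true] at hz
      obtain ⟨a, ha, haz, haE⟩ := hhit z hz
      obtain ⟨q, hq0, hqD, hq⟩ := H.paths x hx hr a ha
      have hzD := H.sep' x hx y (Finset.mem_of_mem_erase hy) (Finset.ne_of_mem_erase hy).symm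
      -- Prepending `z` to the path that starts at `a` and dropping the last vertex gives an induced
      -- path of the same length.
      refine ⟨_, rfl, ?_, hq.cons (z := z) (by rw [hq0]; exact haz.symm) fun j h1 h2 => ?_⟩
      · rintro (_ | _ | j) h1 h2
        · omega
        · simp only [hq0]
          exact haE (Finset.mem_insert_self _ _)
        · exact haE (Finset.mem_insert_of_mem (hqD _ (by omega) (by omega)))
      · have := hzD (q j) (hqD j h1 h2) z (hits_subset _ _ _ hz)
        exact ⟨this.1.symm, fun e => this.2 e.symm⟩
    · intro _ z hz
      simp only [if_true] at hz
      exact hhit z hz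
  · obtain ⟨X, hXZ, ⟨y, hy, P', hP', hyc, hpath⟩, hall⟩ := hG.exists_subset_hit_path hI Z (Z x) l hκ
      (le_trans (by gcongr; linarith) (hZ x hx)) hdis
      (fun j hj => hZ j (Finset.mem_of_mem_erase hj))
    refine ⟨y, hy, fun j => if j = y then P' else Z j \ hits G X (Z j), X,
      ?_, ?_, hXZ.trans Finset.subset_union_left, ?_, ?_, fun h => absurd h hr⟩
    · intro j hj
      by_cases hjy : j = y
      · subst hjy; simpa using hP'
      · simp [hjy]
    · intro j hj
      by_cases hjy : j = y
      · subst hjy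
        simpa using hyc
      · simp only [hjy, if_false]
        have h1 := hall j hj
        have h2 := hcard X j
        have h3 := hbig j (Finset.mem_of_mem_erase hj)
        linarith
    · intro j hj hjy
      simp only [hjy, if_false]
      exact hsep X hXZ j hj
    · simpa [HasPaths] using hpath

/-- The choice of the token whose candidates are used next. -/
theorem exists_next_token {ι : Type*} {I : Finset ι} (hI : I.Nonempty) (d : ℕ) (t h : ι → ℕ)
    (hle : ∀ i ∈ I, h i ≤ d) :
    ∃ x ∈ I, ∀ y ∈ I, (h y < d ∧ t x * (d + 1) + h x ≤ t y * (d + 1) + h y) ∨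
      (h x = d ∧ t y ≤ t x) := by
  classical
  by_cases hc : (I.filter fun i => h i = d).Nonempty
  · obtain ⟨x, hx, hmax⟩ := Finset.exists_max_image _ t hc
    rw [Finset.mem_filter] at hx
    refine ⟨x, hx.1, fun y hy => ?_⟩
    by_cases hyx : t y ≤ t x
    · exact Or.inr ⟨hx.2, hyx⟩
    · left
      have hyd : h y ≠ d := fun e => hyx (hmax y (Finset.mem_filter.2 ⟨hy, e⟩))
      refine ⟨lt_of_le_of_ne (hle y hy) hyd, ?_⟩
      rw [hx.2]
      have : (t x + 1) * (d + 1) ≤ t y * (d + 1) := Nat.mul_le_mul_right _ (by omega)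
      linarith
  · obtain ⟨x, hx, hmin⟩ := Finset.exists_min_image _ (fun i => t i * (d + 1) + h i) hI
    rw [Finset.not_nonempty_iff_eq_empty, Finset.filter_eq_empty_iff] at hc
    exact ⟨x, hx, fun y hy => Or.inl ⟨lt_of_le_of_ne (hle y hy) (hc hy), hmin y hy⟩⟩

/-- Whichever `y` is hit, its new rank is at least one more than the ranks of `x` and `y`, so its
power of two covers both old ones. -/
theorem IsTokenFamily.exists_step [Fintype V] {κ : ℝ} {ι : Type*} [DecidableEq ι] {d l : ℕ}
    (hd : 1 ≤ d) {I : Finset ι} {Z D : ι → Finset V} {t h : ι → ℕ}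
    (H : IsTokenFamily G d l I Z D t h) (hG : Coherent κ G) (hκ : 1 ≤ κ * Fintype.card V)
    (hZ : ∀ i ∈ I, 8 * (l + 3) * (κ * Fintype.card V) ≤ (Z i).card) (hI : 2 ≤ I.card) :
    ∃ x ∈ I, ∃ (Z' D' : ι → Finset V) (t' h' : ι → ℕ),
      IsTokenFamily G d l (I.erase x) Z' D' t' h' ∧
      (∀ j ∈ I.erase x, ((Z j).card : ℝ) ≤ 8 * (Z' j).card) ∧
      ∑ i ∈ I, 2 ^ (t i * (d + 1) + h i) ≤ ∑ i ∈ I.erase x, 2 ^ (t' i * (d + 1) + h' i) := by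
  obtain ⟨x, hx, hnext⟩ := exists_next_token (Finset.card_pos.1 (by omega)) d t h H.legs_le
  have hI' : (I.erase x).Nonempty := by
    rw [← Finset.card_pos, Finset.card_erase_of_mem hx]; omega
  obtain ⟨y, hy, Z', E, hZ', hcard, hE, hsep, hpath, hatt⟩ := H.exists_hit hG hκ hZ hx hI'
  have hyI := Finset.mem_of_mem_erase hy
  have hyx := Finset.ne_of_mem_erase hy
  have hsepE : Separated G (D y) E := by
    intro b hb e he
    rcases Finset.mem_union.1 (hE he) with he | he
    · exact H.sep' y hyI x hx hyx b hb e he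
    · exact H.sep y hyI x hx hyx b hb e he
  suffices hs : ∃ s g, g ≤ d ∧ (∀ z ∈ Z' y, HasCat G d l s g (D y ∪ E) z) ∧
      t x * (d + 1) + h x + 1 ≤ s * (d + 1) + g ∧ t y * (d + 1) + h y + 1 ≤ s * (d + 1) + g by
    obtain ⟨s, g, hgd, hcat, h1, h2⟩ := hs
    refine ⟨x, hx, Z', _, _, _, H.merge hx hy hZ' hE hsep hgd hcat hpath, hcard, ?_⟩
    rw [← Finset.add_sum_erase I _ hx, ← Finset.add_sum_erase (I.erase x) _ hy,
      ← Finset.add_sum_erase (I.erase x) _ hy, ← add_assoc]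
    refine add_le_add ?_ (Finset.sum_le_sum fun i hi => ?_)
    · simp only [Function.update_self]
      have h3 : 2 ^ (t x * (d + 1) + h x + 1) ≤ 2 ^ (s * (d + 1) + g) :=
        Nat.pow_le_pow_right (by norm_num) h1
      have h4 : 2 ^ (t y * (d + 1) + h y + 1) ≤ 2 ^ (s * (d + 1) + g) :=
        Nat.pow_le_pow_right (by norm_num) h2
      rw [pow_succ] at h3 h4
      omega
    · simp [Finset.ne_of_mem_erase hi]
  rcases hnext y hyI with ⟨hyd, hxy⟩ | ⟨hxd, hyt⟩
  · refine ⟨t y, h y + 1, hyd, fun z hz => ?_, by omega, by omega⟩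
    obtain ⟨q, hq0, hqE, hq⟩ := hpath z hz
    exact (H.cat y hyI z (hZ' y hy hz)).add_leg hyd hq0 hqE hq hsepE
  · have h1 : (t x + 1) * (d + 1) = t x * (d + 1) + d + 1 := by ring
    have h2 : t y * (d + 1) ≤ t x * (d + 1) := Nat.mul_le_mul_right _ hyt
    refine ⟨t x + 1, h y, H.legs_le y hyI, fun z hz => ?_, by omega, by omega⟩
    -- A token with all `d` legs is not bare because `1 ≤ d`, so its whole caterpillar is available
    -- in `E`.
    obtain ⟨a, ha, haz, haE⟩ := hatt (by omega) z hz
    have hcx := H.cat x hx a ha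
    rw [hxd] at hcx
    refine (hcx.add_spine (H.cat y hyI z (hZ' y hy hz)) hyt haz (hsepE.symm.mono haE subset_rfl)
      ((H.sep' x hx y hyI hyx.symm).mono subset_rfl
        (Finset.singleton_subset_iff.2 (hZ' y hy hz)))).mono
      (Finset.union_subset_union_right haE)

end Tokens

/-- With `k + 1` tokens there are `k` rounds, each of which shrinks the candidate sets at most by a
factor 8; `κ` is taken small enough to be negligible against the sets in all rounds. -/
theorem exists_hasCat_of_isTokenFamily {N d l : ℕ} (hd : 1 ≤ d) (k : ℕ) : ∀ c : ℝ, 0 < c →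
    ∃ κ : ℝ, 0 < κ ∧ ∀ (V : Type u) [Fintype V] (G : SimpleGraph V), Coherent κ G →
      1 ≤ κ * Fintype.card V → ∀ (I : Finset (Fin N)) (Z D : Fin N → Finset V) (t h : Fin N → ℕ),
      IsTokenFamily G d l I Z D t h → I.card = k + 1 →
      (∀ i ∈ I, c * Fintype.card V ≤ (Z i).card) →
      ∃ s g D' z, g ≤ d ∧ HasCat G d l s g D' z ∧
        ∑ i ∈ I, 2 ^ (t i * (d + 1) + h i) ≤ 2 ^ (s * (d + 1) + g) := by
  induction k with
  | zero =>
    intro c hc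
    refine ⟨1, one_pos, fun V _ G _ hn I Z D t h H hI hZ => ?_⟩
    obtain ⟨i, rfl⟩ := Finset.card_eq_one.1 hI
    have hi := Finset.mem_singleton_self i
    have hne : (Z i).Nonempty := by
      rw [← Finset.card_pos]
      have h1 : (0 : ℝ) < c * Fintype.card V := mul_pos hc (by linarith)
      exact_mod_cast h1.trans_le (hZ i hi)
    obtain ⟨z, hz⟩ := hne
    exact ⟨t i, h i, D i, z, H.legs_le i hi, H.cat i hi z hz, by simp⟩
  | succ k ih =>
    intro c hc
    obtain ⟨κ', hκ', ih⟩ := ih (c / 8) (by positivity)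
    have hl : (0 : ℝ) < 8 * (l + 3) := by positivity
    refine ⟨min κ' (c / (8 * (l + 3))), lt_min hκ' (div_pos hc hl),
      fun V _ G hG hn I Z D t h H hI hZ => ?_⟩
    classical
    set κ := min κ' (c / (8 * (l + 3))) with hκdef
    obtain ⟨x, hx, Z', D', t', h', H', hcard, hsum⟩ := H.exists_step hd hG hn (fun i hi => by
      refine le_trans ?_ (hZ i hi)
      rw [← mul_assoc]
      gcongr
      calc 8 * ((l : ℝ) + 3) * κ ≤ 8 * (l + 3) * (c / (8 * (l + 3))) := by
            gcongr
            exact min_le_right _ _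
        _ = c := by field_simp) (by omega)
    obtain ⟨s, g, D'', z, hg, hcat, hle⟩ := ih V G (hG.mono (min_le_left _ _))
      (hn.trans (by gcongr; exact min_le_left _ _)) (I.erase x) Z' D' t' h' H'
      (by rw [Finset.card_erase_of_mem hx]; omega) (fun i hi => by
        have h1 := hcard i hi
        have h2 := hZ i (Finset.mem_of_mem_erase hi)
        linarith)
    exact ⟨s, g, D'', z, hg, hcat, hsum.trans hle⟩

/-- Coherent graphs contain every caterpillar: here one with `m` spine vertices, each with `d` legs
of length `l`. -/
theorem exists_forall_coherent_exists_caterpillar (m : ℕ) {d l : ℕ} (hd : 1 ≤ d) :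
    ∃ κ : ℝ, 0 < κ ∧ ∀ (V : Type u) [Fintype V] (G : SimpleGraph V), Coherent κ G →
      1 ≤ κ * Fintype.card V → ∃ f : ℕ × ℕ × ℕ → V, ∀ a b : ℕ × ℕ × ℕ, a.1 < m → b.1 < m →
        ((a.2.1 = 0 ∧ a.2.2 = 0) ∨ (1 ≤ a.2.2 ∧ a.2.2 ≤ l ∧ a.2.1 < d)) →
        ((b.2.1 = 0 ∧ b.2.2 = 0) ∨ (1 ≤ b.2.2 ∧ b.2.2 ≤ l ∧ b.2.1 < d)) →
        (f a = f b → a = b) ∧ (G.Adj (f a) (f b) ↔ LegAdj a b) := by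
  set N := 2 ^ (m * (d + 1)) with hN
  have hN0 : 0 < N := by positivity
  have hNr : (0 : ℝ) < N := by exact_mod_cast hN0
  obtain ⟨κ₀, hκ₀, key⟩ := exists_hasCat_of_isTokenFamily.{u} (N := N) (l := l) hd (N - 1)
    (1 / (2 * N)) (by positivity)
  refine ⟨min κ₀ (1 / N), lt_min hκ₀ (by positivity), fun V _ G hG hn => ?_⟩
  set n := Fintype.card V with hndef
  have hnN : N ≤ n := by
    have h1 : 1 ≤ 1 / (N : ℝ) * n := hn.trans (by gcongr; exact min_le_right _ _)
    rw [one_div, ← div_eq_inv_mul, le_div_iff₀ hNr, one_mul] at h1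
    exact_mod_cast h1
  obtain ⟨Z, -, hZc, hZd⟩ := Finset.exists_disjoint_family N (n / N) (Finset.univ : Finset V)
    (by rw [Finset.card_univ]; exact Nat.mul_div_le n N)
  have hempty : ∀ B : Finset V, Separated G ∅ B := fun B a ha => absurd ha (Finset.notMem_empty a)
  obtain ⟨s, g, D, z, hg, ⟨f, -, -, hf⟩, hle⟩ := key V G (hG.mono (min_le_left _ _))
    (hn.trans (by gcongr; exact min_le_left _ _)) Finset.univ Z (fun _ => ∅) (fun _ => 0)
    (fun _ => 0) ⟨fun _ _ => Nat.zero_le _, fun i _ j _ hij => hZd i j hij,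
      fun _ _ _ _ _ => hempty _, fun _ _ _ _ _ => hempty _, fun _ _ z _ => hasCat_bare G d l _ z,
      fun _ _ h => by simp at h⟩ (by rw [Finset.card_univ, Fintype.card_fin]; omega) (fun i _ => by
        rw [hZc]
        have h1 : 1 ≤ n / N := Nat.div_pos hnN hN0
        have h2 : n < N * (n / N + 1) := Nat.lt_mul_div_succ n hN0
        have h3 : n ≤ 2 * N * (n / N) := by nlinarith
        rw [one_div, ← div_eq_inv_mul, div_le_iff₀ (by positivity), mul_comm]
        exact_mod_cast h3)
  -- The last spine vertex has at most `d` legs, so its rank is below `(s + 1) * (d + 1)`. All spine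
  -- vertices with index below `m` precede index `s` or are earlier, hence carry `d` legs.
  have hms : m ≤ s := by
    have h1 : 2 ^ (m * (d + 1)) ≤ 2 ^ (s * (d + 1) + g) := by
      simpa [hN] using hle
    have h2 := (Nat.pow_le_pow_iff_right (by norm_num)).1 h1
    have h3 : m * (d + 1) < (s + 1) * (d + 1) := by linarith
    exact Nat.lt_succ_iff.1 (lt_of_mul_lt_mul_right h3 (Nat.zero_le _))
  refine ⟨f, fun a b ha hb ha' hb' => hf a b ?_ ?_⟩
  · unfold IsCatVertex
    omega
  · unfold IsCatVertex
    omega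

/-! ### Coordinates of a caterpillar in the universal caterpillar. -/

section Chart

variable {U : Type v} {T : SimpleGraph U}

/-- Otherwise the path through `x` and a path inside `W` would be two different paths from `y` to
`z`. -/
theorem SimpleGraph.IsAcyclic.eq_of_adj_of_walk (hT : T.IsAcyclic) {x y z : U} (W : T.Walk y z)
    (hx : x ∉ W.support) (hy : T.Adj x y) (hz : T.Adj x z) : y = z := by
  classical
  by_contra hne
  have h1 : W.bypass.IsPath := W.bypass_isPath
  have h2 : (SimpleGraph.Walk.cons hy.symm (SimpleGraph.Walk.cons hz .nil)).IsPath := by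
    simp [SimpleGraph.Walk.cons_isPath_iff, hy.ne', hz.ne, hne]
  have h3 := congrArg Subtype.val ((hT.subsingleton_path y z).elim ⟨_, h1⟩ ⟨_, h2⟩)
  simp only at h3
  apply hx
  apply W.support_bypass_subset_support
  rw [h3]
  simp

theorem SimpleGraph.IsTree.dist_getVert (hT : T.IsTree) {a b : U} {p : T.Walk a b} (hp : p.IsPath)
    {i : ℕ} (hi : i ≤ p.length) : T.dist a (p.getVert i) = i := by
  obtain ⟨W, hW, hWl⟩ := hT.1.exists_path_of_dist a (p.getVert i)
  have h := congrArg Subtype.val ((hT.2.subsingleton_path _ _).elim ⟨W, hW⟩ ⟨p.take i, hp.take i⟩)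
  simp only at h
  rw [← hWl, h, SimpleGraph.Walk.take_length]
  omega

/-- Coordinates on a part `S` of a tree that contains the spine `P`. -/
structure IsChart (T : SimpleGraph U) (P : Set U) (a : U) (n : ℕ) (e : U → ℕ) (S : Finset U)
    (φ : U → ℕ × ℕ × ℕ) : Prop where
  spine_subset : ∀ v ∈ P, v ∈ S
  spine : ∀ v ∈ P, (φ v).2 = (0, 0)
  walk : ∀ v ∈ S, ∃ W : T.Walk a v, ∀ w ∈ W.support, w ∈ S
  inj : ∀ v ∈ S, ∀ w ∈ S, φ v = φ w → v = w
  adj : ∀ v ∈ S, ∀ w ∈ S, (T.Adj v w ↔ LegAdj (φ v) (φ w))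
  pred : ∀ v ∈ S, v ∉ P → ∃ w ∈ S, (φ w).1 = (φ v).1 ∧ (φ w).2.2 + 1 = (φ v).2.2 ∧
    ((φ w).2.2 = 0 ∨ (φ w).2.1 = (φ v).2.1)
  leg : ∀ v ∈ S, v ∉ P → ∃ w ∈ S, (φ v).2.1 = e w
  lt : ∀ v ∈ S, (φ v).1 < n
  depth : ∀ v ∈ S, (φ v).2.2 < S.card

theorem LegAdj.of_pred {a b : ℕ × ℕ × ℕ} (h1 : a.1 = b.1) (h2 : a.2.2 + 1 = b.2.2)
    (h3 : a.2.2 = 0 ∨ a.2.1 = b.2.1) : LegAdj a b :=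
  Or.inr ⟨h1, by tauto, Or.inl h2⟩

variable [Fintype U] [DecidableEq U]

/-- A vertex `x` outside `S` next to some `y` in `S` has no other neighbour in `S`, as `T` is
acyclic. It starts a new leg if `y` is on the spine, and otherwise prolongs the leg of `y`. -/
theorem IsChart.exists_insert [T.LocallyFinite] {P : Set U} {a : U} {n : ℕ} {e : U → ℕ}
    {S : Finset U} {φ : U → ℕ × ℕ × ℕ} (hφ : IsChart T P a n e S φ) (hT : T.IsTree)
    (hP : ∀ x, 3 ≤ T.degree x → x ∈ P) (ha : a ∈ S) (he : Function.Injective e)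
    (hS : S ≠ Finset.univ) : ∃ x ∉ S, ∃ c, IsChart T P a n e (insert x S) (Function.update φ x c) := by
  obtain ⟨x₀, hx₀⟩ : ∃ x, x ∉ S := by
    by_contra! h
    exact hS (Finset.eq_univ_iff_forall.2 h)
  obtain ⟨W₀⟩ := hT.1.preconnected a x₀
  obtain ⟨⟨⟨y, x⟩, hyx⟩, -, hy, hx⟩ := W₀.exists_boundary_dart (S : Set U) ha hx₀
  simp only [Finset.mem_coe] at hy hx hyx
  have hxP : x ∉ P := fun h => hx (hφ.spine_subset x h)
  have hxadj : ∀ v ∈ S, (T.Adj v x ↔ v = y) := by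
    refine fun v hv => ⟨fun h => ?_, fun h => h ▸ hyx⟩
    obtain ⟨W₁, h₁⟩ := hφ.walk v hv
    obtain ⟨W₂, h₂⟩ := hφ.walk y hy
    refine hT.2.eq_of_adj_of_walk (W₁.reverse.append W₂) (fun hm => hx ?_) h.symm hyx.symm
    rw [SimpleGraph.Walk.mem_support_append_iff, SimpleGraph.Walk.support_reverse,
      List.mem_reverse] at hm
    exact hm.elim (h₁ x) (h₂ x)
  have hzero : ∀ v ∈ S, ((φ v).2.2 = 0 ↔ v ∈ P) := by
    refine fun v hv => ⟨fun h => ?_, fun h => by rw [hφ.spine v h]⟩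
    by_contra hvP
    obtain ⟨w, -, -, h2, -⟩ := hφ.pred v hv hvP
    omega
  have hvx : ∀ v ∈ S, v ≠ x := fun v hv h => hx (h ▸ hv)
  -- A new leg is named after its first vertex, so the injectivity of `e` keeps the names distinct.
  set c : ℕ × ℕ × ℕ := ((φ y).1, if (φ y).2.2 = 0 then e x else (φ y).2.1, (φ y).2.2 + 1) with hc
  have hyc : LegAdj (φ y) c := by
    refine LegAdj.of_pred rfl rfl ?_
    by_cases h : (φ y).2.2 = 0
    · exact Or.inl h
    · right; simp [hc, h]
  have hfresh : ∀ v ∈ S, φ v ≠ c := by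
    intro v hv hvc
    have hvP : v ∉ P := fun h => by
      have h1 := (hzero v hv).2 h
      rw [hvc] at h1
      simp [hc] at h1
    by_cases hk : (φ y).2.2 = 0
    · obtain ⟨w, hw, hwe⟩ := hφ.leg v hv hvP
      rw [hvc] at hwe
      simp only [hc, hk, if_true] at hwe
      exact hvx w hw (he hwe).symm
    · have hyP : y ∉ P := fun h => hk ((hzero y hy).2 h)
      obtain ⟨w, hw, h1, h2, h3⟩ := hφ.pred y hy hyP
      have hwy : T.Adj w y := (hφ.adj w hw y hy).2 (LegAdj.of_pred h1 h2 h3)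
      have hyv : T.Adj y v := (hφ.adj y hy v hv).2 (hvc ▸ hyc)
      have hwv : w ≠ v := by
        rintro rfl
        rw [hvc] at h2
        simp only [hc] at h2
        omega
      -- If `v` already held these coordinates, then `y`, off the spine, would have the three
      -- neighbours `w`, `v` and `x`.
      refine hyP (hP y ?_)
      have hsub : ({w, v, x} : Finset U) ⊆ T.neighborFinset y := by
        intro z hz
        rw [SimpleGraph.mem_neighborFinset]
        simp only [Finset.mem_insert, Finset.mem_singleton] at hz
        rcases hz with rfl | rfl | rfl
        · exact hwy.symm
        · exact hyv
        · exact hyx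
      rw [← SimpleGraph.card_neighborFinset_eq_degree]
      refine le_trans ?_ (Finset.card_le_card hsub)
      rw [Finset.card_eq_three.2 ⟨w, v, x, hwv, hvx w hw, hvx v hv, rfl⟩]
  have hadj : ∀ v ∈ S, (LegAdj (φ v) c ↔ v = y) := by
    refine fun v hv => ⟨fun h => ?_, fun h => h ▸ hyc⟩
    have h1 : (φ v).1 = (φ y).1 ∧ (c.2.1 = (φ v).2.1 ∨ (φ v).2.2 = 0) ∧
        ((φ v).2.2 = (φ y).2.2 + 2 ∨ (φ v).2.2 = (φ y).2.2) := by
      have h2 : c.1 = (φ y).1 := rfl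
      have h3 : c.2.2 = (φ y).2.2 + 1 := rfl
      unfold LegAdj at h
      omega
    obtain ⟨h1, h2, h3 | h3⟩ := h1
    -- A vertex one level beyond `c` would have a predecessor with coordinates `c`.
    · exfalso
      obtain ⟨w, hw, h4, h5, h6⟩ := hφ.pred v hv fun h => by
        have := (hzero v hv).2 h
        omega
      refine hfresh w hw (Prod.ext (h4.trans h1) (Prod.ext ?_ ?_))
      · rw [h6.resolve_left (by omega)]
        exact (h2.resolve_right (by omega)).symm
      · have h7 : c.2.2 = (φ y).2.2 + 1 := rfl
        omega
    · refine hφ.inj v hv y hy (Prod.ext h1 ?_)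
      by_cases hk : (φ y).2.2 = 0
      · rw [hφ.spine v ((hzero v hv).1 (h3.trans hk)), hφ.spine y ((hzero y hy).1 hk)]
      · refine Prod.ext ?_ h3
        rw [← h2.resolve_right (by omega)]
        simp [hc, hk]
  have hup : ∀ v ∈ S, Function.update φ x c v = φ v := fun v hv =>
    Function.update_of_ne (hvx v hv) _ _
  refine ⟨x, hx, c, ?_, ?_, ?_, ?_, ?_, ?_, ?_, ?_, ?_⟩
  · exact fun v hv => Finset.mem_insert_of_mem (hφ.spine_subset v hv)
  · exact fun v hv => by rw [hup v (hφ.spine_subset v hv), hφ.spine v hv]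
  · intro v hv
    rcases Finset.mem_insert.1 hv with rfl | hv
    · obtain ⟨W, hW⟩ := hφ.walk y hy
      refine ⟨W.concat hyx, fun w hw => ?_⟩
      rw [SimpleGraph.Walk.support_concat, List.mem_append, List.mem_singleton] at hw
      rcases hw with hw | rfl
      · exact Finset.mem_insert_of_mem (hW w hw)
      · exact Finset.mem_insert_self _ _
    · obtain ⟨W, hW⟩ := hφ.walk v hv
      exact ⟨W, fun w hw => Finset.mem_insert_of_mem (hW w hw)⟩
  · intro v hv' w hw'
    rcases Finset.mem_insert.1 hv' with rfl | hv <;> rcases Finset.mem_insert.1 hw' with rfl | hw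
    · exact fun _ => rfl
    · rw [hup w hw, Function.update_self]
      exact fun h => absurd h.symm (hfresh w hw)
    · rw [hup v hv, Function.update_self]
      exact fun h => absurd h (hfresh v hv)
    · rw [hup v hv, hup w hw]
      exact hφ.inj v hv w hw
  · intro v hv' w hw'
    rcases Finset.mem_insert.1 hv' with rfl | hv <;> rcases Finset.mem_insert.1 hw' with rfl | hw
    · rw [Function.update_self]
      simp [LegAdj]
    · rw [hup w hw, Function.update_self, T.adj_comm, hxadj w hw, ← hadj w hw]
      exact ⟨LegAdj.symm, LegAdj.symm⟩
    · rw [hup v hv, Function.update_self, hxadj v hv, hadj v hv]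
    · rw [hup v hv, hup w hw]
      exact hφ.adj v hv w hw
  · intro v hv hvP
    rcases Finset.mem_insert.1 hv with rfl | hv
    · refine ⟨y, Finset.mem_insert_of_mem hy, ?_⟩
      rw [hup y hy, Function.update_self]
      refine ⟨rfl, rfl, ?_⟩
      by_cases h : (φ y).2.2 = 0
      · exact Or.inl h
      · right; simp [hc, h]
    · obtain ⟨w, hw, h⟩ := hφ.pred v hv hvP
      refine ⟨w, Finset.mem_insert_of_mem hw, ?_⟩
      rwa [hup v hv, hup w hw]
  · intro v hv hvP
    rcases Finset.mem_insert.1 hv with rfl | hv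
    · rw [Function.update_self]
      by_cases h : (φ y).2.2 = 0
      · exact ⟨v, Finset.mem_insert_self _ _, by simp [hc, h]⟩
      · obtain ⟨w, hw, hwe⟩ := hφ.leg y hy fun hyP => h ((hzero y hy).2 hyP)
        exact ⟨w, Finset.mem_insert_of_mem hw, by simp [hc, h, hwe]⟩
    · obtain ⟨w, hw, h⟩ := hφ.leg v hv hvP
      refine ⟨w, Finset.mem_insert_of_mem hw, ?_⟩
      rwa [hup v hv]
  · intro v hv
    rcases Finset.mem_insert.1 hv with rfl | hv
    · rw [Function.update_self]
      exact hφ.lt y hy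
    · rw [hup v hv]
      exact hφ.lt v hv
  · intro v hv
    rw [Finset.card_insert_of_notMem hx]
    rcases Finset.mem_insert.1 hv with rfl | hv
    · rw [Function.update_self]
      exact Nat.succ_lt_succ (hφ.depth y hy)
    · rw [hup v hv]
      exact (hφ.depth v hv).trans (Nat.lt_succ_self _)

theorem exists_isChart_support (hT : T.IsTree) {a b : U} {p : T.Walk a b} (hp : p.IsPath)
    (e : U → ℕ) : ∃ φ, IsChart T {x | x ∈ p.support} a (Fintype.card U) e p.support.toFinset φ := by
  have hidx : ∀ v ∈ p.support, ∃ i ≤ p.length, p.getVert i = v ∧ T.dist a v = i := by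
    intro v hv
    obtain ⟨i, rfl, hi⟩ := SimpleGraph.Walk.mem_support_iff_exists_getVert.1 hv
    exact ⟨i, hi, rfl, hT.dist_getVert hp hi⟩
  refine ⟨fun v => (T.dist a v, 0, 0), by simp, fun _ _ => rfl, ?_, ?_, ?_, ?_, ?_, ?_, ?_⟩
  · intro v hv
    rw [List.mem_toFinset] at hv
    exact ⟨p.takeUntil v hv, fun w hw => List.mem_toFinset.2 (p.support_takeUntil_subset_support hv hw)⟩
  · intro v hv w hw h
    rw [List.mem_toFinset] at hv hw
    obtain ⟨i, -, rfl, hi⟩ := hidx v hv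
    obtain ⟨j, -, rfl, hj⟩ := hidx w hw
    simp only [Prod.mk.injEq, and_true] at h
    congr 1
    omega
  · intro v hv w hw
    rw [List.mem_toFinset] at hv hw
    obtain ⟨i, hi, rfl, hi'⟩ := hidx v hv
    obtain ⟨j, hj, rfl, hj'⟩ := hidx w hw
    simp only [LegAdj, hi', hj', true_and]
    constructor
    · intro h
      have h1 := hT.1.dist_triangle (u := a) (v := p.getVert i) (w := p.getVert j)
      have h2 := hT.1.dist_triangle (u := a) (v := p.getVert j) (w := p.getVert i)
      rw [SimpleGraph.dist_eq_one_iff_adj.2 h] at h1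
      rw [SimpleGraph.dist_eq_one_iff_adj.2 h.symm] at h2
      have h3 : i ≠ j := by
        rintro rfl
        exact h.ne rfl
      omega
    · intro h
      have h1 : i + 1 = j ∨ j + 1 = i := by omega
      rcases h1 with rfl | rfl
      · exact p.adj_getVert_succ (by omega)
      · exact (p.adj_getVert_succ (by omega)).symm
  · exact fun v hv h => absurd (List.mem_toFinset.1 hv) h
  · exact fun v hv h => absurd (List.mem_toFinset.1 hv) h
  · intro v hv
    obtain ⟨i, hi, -, hi'⟩ := hidx v (List.mem_toFinset.1 hv)
    simp only [hi']
    exact hi.trans_lt hp.length_lt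
  · exact fun v hv => Finset.card_pos.2 ⟨v, hv⟩

/-- A caterpillar is an induced subgraph of the universal caterpillar. -/
theorem IsCaterpillar.exists_coordinates [T.LocallyFinite] (hT : IsCaterpillar T) :
    ∃ φ : U → ℕ × ℕ × ℕ, Function.Injective φ ∧ (∀ v w, T.Adj v w ↔ LegAdj (φ v) (φ w)) ∧
      ∀ v, (φ v).1 < Fintype.card U ∧ (((φ v).2.1 = 0 ∧ (φ v).2.2 = 0) ∨
        (1 ≤ (φ v).2.2 ∧ (φ v).2.2 ≤ Fintype.card U ∧ (φ v).2.1 < Fintype.card U)) := by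
  obtain ⟨hT, a, b, p, hp, hdeg⟩ := hT
  set e : U → ℕ := fun x => (Fintype.equivFin U x : ℕ) with he
  have hinj : Function.Injective e := Fin.val_injective.comp (Fintype.equivFin U).injective
  set P : Set U := {x | x ∈ p.support} with hPdef
  have key : ∀ k (S : Finset U) φ, Fintype.card U - S.card = k →
      IsChart T P a (Fintype.card U) e S φ →
      ∃ ψ, IsChart T P a (Fintype.card U) e Finset.univ ψ := by
    intro k
    induction k with
    | zero =>
      intro S φ hk hφ
      have := Finset.card_le_univ S
      obtain rfl : S = Finset.univ := (Finset.card_eq_iff_eq_univ S).1 (by omega)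
      exact ⟨φ, hφ⟩
    | succ k ih =>
      intro S φ hk hφ
      obtain ⟨x, hx, c, h⟩ := hφ.exists_insert hT hdeg
        (hφ.spine_subset a p.start_mem_support) hinj (by
          rintro rfl
          simp at hk)
      refine ih _ _ ?_ h
      rw [Finset.card_insert_of_notMem hx]
      omega
  obtain ⟨φ₀, h₀⟩ := exists_isChart_support hT hp e
  obtain ⟨φ, hφ⟩ := key _ _ φ₀ rfl h₀
  refine ⟨φ, fun v w h => hφ.inj v (Finset.mem_univ v) w (Finset.mem_univ w) h,
    fun v w => hφ.adj v (Finset.mem_univ v) w (Finset.mem_univ w), fun v =>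
    ⟨hφ.lt v (Finset.mem_univ v), ?_⟩⟩
  by_cases hv : v ∈ P
  · rw [hφ.spine v hv]
    simp
  · obtain ⟨w, -, -, h2, -⟩ := hφ.pred v (Finset.mem_univ v) hv
    obtain ⟨u, -, hu⟩ := hφ.leg v (Finset.mem_univ v) hv
    have h3 := hφ.depth v (Finset.mem_univ v)
    rw [Finset.card_univ] at h3
    exact Or.inr ⟨by omega, h3.le, hu ▸ (Fintype.equivFin U u).2⟩

end Chart

/-! ### From coherent graphs to the theorem. -/

theorem IsCaterpillar.exists_forall_coherent_isIndContained {U : Type v} [Fintype U]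
    {T : SimpleGraph U} [T.LocallyFinite] (hT : IsCaterpillar T) :
    ∃ κ : ℝ, 0 < κ ∧ ∀ (V : Type u) [Fintype V] (G : SimpleGraph V), Coherent κ G →
      1 ≤ κ * Fintype.card V → T.IsIndContained G := by
  classical
  have : Nonempty U := hT.1.1.nonempty
  obtain ⟨φ, hinj, hadj, hφ⟩ := hT.exists_coordinates
  obtain ⟨κ, hκ, key⟩ := exists_forall_coherent_exists_caterpillar.{u} (Fintype.card U)
    (d := Fintype.card U) (l := Fintype.card U) Fintype.card_pos
  refine ⟨κ, hκ, fun V _ G hG hn => ?_⟩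
  obtain ⟨f, hf⟩ := key V G hG hn
  have hf' := fun v w => hf (φ v) (φ w) (hφ v).1 (hφ w).1 (hφ v).2 (hφ w).2
  exact ⟨⟨⟨fun v => f (φ v), fun v w h => hinj ((hf' v w).1 h)⟩, fun {v w} =>
    (hf' v w).2.trans (hadj v w).symm⟩⟩

/-- Without such a pair the graph induced on `X` would be coherent and so contain `T`. -/
theorem IsCaterpillar.exists_antiAdjacent {U : Type v} [Fintype U] {T : SimpleGraph U}
    [T.LocallyFinite] (hT : IsCaterpillar T) :
    ∃ κ : ℝ, 0 < κ ∧ ∀ (V : Type u) (G : SimpleGraph V) (X : Finset V), ¬ T.IsIndContained G →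
      (∀ v ∈ X, ((nbrsIn G v X).card : ℝ) ≤ κ * X.card) → 1 ≤ κ * X.card →
      ∃ A B : Finset V, Disjoint A B ∧ κ * X.card ≤ A.card ∧ κ * X.card ≤ B.card ∧
        AntiAdjacent G A B := by
  classical
  obtain ⟨κ, hκ, key⟩ := hT.exists_forall_coherent_isIndContained.{u}
  refine ⟨κ, hκ, fun V G X hTG hdeg hX => ?_⟩
  by_contra! hcon
  have hcard : Fintype.card (X : Set V) = X.card := by simp
  have hsub : (G.induce (X : Set V)).IsIndContained G := ⟨SimpleGraph.Embedding.induce _⟩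
  refine hTG ((key (X : Set V) (G.induce (X : Set V)) ⟨fun v => ?_, fun A B hAB hA hB => ?_⟩
    (by rwa [hcard])).trans hsub)
  · rw [hcard]
    refine le_trans ?_ (hdeg v v.2)
    have h : (nbrsIn (G.induce (X : Set V)) v Finset.univ).map (Function.Embedding.subtype _) ⊆
        nbrsIn G v X := by
      intro x hx
      obtain ⟨y, hy, rfl⟩ := Finset.mem_map.1 hx
      exact mem_nbrsIn.2 ⟨y.2, (mem_nbrsIn.1 hy).2⟩
    have h' := Finset.card_le_card h
    rw [Finset.card_map] at h'
    exact_mod_cast h'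
  · rw [hcard] at hA hB
    have h := hcon (A.map (Function.Embedding.subtype _)) (B.map (Function.Embedding.subtype _))
      ((Finset.disjoint_map _).2 hAB) (by rwa [Finset.card_map]) (by rwa [Finset.card_map])
    simp only [AntiAdjacent] at h
    push Not at h
    obtain ⟨a, ha, b, hb, hab⟩ := h
    obtain ⟨a', ha', rfl⟩ := Finset.mem_map.1 ha
    obtain ⟨b', hb', rfl⟩ := Finset.mem_map.1 hb
    exact ⟨a', ha', b', hb', hab⟩

theorem exists_fully_or_antiAdjacent_pair {V : Type u} [Fintype V] (G : SimpleGraph V) {δ : ℝ}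
    (hn : Fintype.card V ≠ 1) (hδ : δ * Fintype.card V ≤ 1) :
    ∃ A B : Finset V, Disjoint A B ∧ δ * (Fintype.card V : ℝ) ≤ (A.card : ℝ) ∧
      δ * (Fintype.card V : ℝ) ≤ (B.card : ℝ) ∧ (FullyAdjacent G A B ∨ AntiAdjacent G A B) := by
  rcases Nat.lt_or_gt_of_ne hn with h | h
  · have h0 : Fintype.card V = 0 := by omega
    refine ⟨∅, ∅, Finset.disjoint_empty_left _, by simp [h0], by simp [h0], Or.inr ?_⟩
    simp [AntiAdjacent]
  · obtain ⟨a, b, hab⟩ := Fintype.exists_pair_of_one_lt_card h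
    refine ⟨{a}, {b}, Finset.disjoint_singleton.2 hab, by simpa using hδ, by simpa using hδ, ?_⟩
    simpa [FullyAdjacent, AntiAdjacent] using em (G.Adj a b)

theorem theorem1 {U : Type v} [Fintype U] (T : SimpleGraph U) [DecidableRel T.Adj]
    (hT : IsCaterpillar T) :
    HasStrongErdosHajnalProperty.{u} (ExcludesWithComplement T) := by
  have : Nonempty U := hT.1.1.nonempty
  obtain ⟨κ, hκ, key⟩ := hT.exists_antiAdjacent.{u}
  obtain ⟨δ, hδ, hX⟩ := exists_sparse_or_cosparse.{u} T hκ
  -- The bound by `1` makes the case of large `n` imply `1 ≤ δ * n`; for small `n` two single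
  -- vertices are enough, or empty sets if `n = 0`.
  refine ⟨δ * min κ 1, by positivity, fun V _ G hG hn => ?_⟩
  set n : ℝ := (Fintype.card V : ℝ)
  rcases le_total (δ * min κ 1 * n) 1 with hsmall | hlarge
  · exact exists_fully_or_antiAdjacent_pair G hn hsmall
  have hn0 : 0 ≤ n := Nat.cast_nonneg _
  have h1 : 1 ≤ δ * n := hlarge.trans (by
    rw [mul_right_comm]
    exact mul_le_of_le_one_right (by positivity) (min_le_right _ _))
  obtain ⟨X, hXc, hXd⟩ := hX V G hG.1 h1
  have h2 : δ * min κ 1 * n ≤ κ * X.card := by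
    calc δ * min κ 1 * n = min κ 1 * (δ * n) := by ring
      _ ≤ κ * X.card := by
        gcongr
        exact min_le_left _ _
  rcases hXd with hXd | hXd
  · obtain ⟨A, B, hAB, hA, hB, h⟩ := key V G X hG.1 hXd (hlarge.trans h2)
    exact ⟨A, B, hAB, h2.trans hA, h2.trans hB, Or.inr h⟩
  -- An induced `T` in `Gᶜ` is an induced `Tᶜ` in `G`, so the sparse case applies to `Gᶜ`.
  · obtain ⟨A, B, hAB, hA, hB, h⟩ := key V Gᶜ X (fun h => hG.2 (by simpa using h.compl)) hXd (hlarge.trans h2)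
    refine ⟨A, B, hAB, h2.trans hA, h2.trans hB, Or.inl fun a ha b hb => ?_⟩
    have hne : a ≠ b := fun e => Finset.disjoint_left.1 hAB ha (e ▸ hb)
    have := h a ha b hb
    rw [SimpleGraph.compl_adj] at this
    tauto
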